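/- Let $k=\mathbb F_q$ be a finite field of odd characteristic and let $Q$ be a finite quiver with nodes $Q_0$ and arrows $Q_1$. Let $\sigma$ be a contravariant involution of $Q$: involutions of $Q_0$ and $Q_1$ such that $\sigma$ sends an arrow $i\xrightarrow{\alpha}j$ to an arrow $\sigma(j)\xrightarrow{\sigma(\alpha)}\sigma(i)$ and fixes every arrow of the form $i\to\sigma(i)$. Fix a duality structure: signs $s:Q_0\to\{\pm1\}$, $\tau:Q_1\to\{\pm1\}$ with $s_{\sigma(i)}=s_i$ and $\tau_\alpha\tau_{\sigma(\alpha)}=s_is_j$ for $\alpha:i\to j$. Write $\Lambda_Q=\mathbb ZQ_0$, let $\Lambda_Q^+=\mathbb Z_{\ge0}Q_0$ be the dimension vectors, $\Lambda_Q^{\sigma,+}$ the $\sigma$-invariant ones, and $H(d)=d+\sigma(d)$. Let $\theta\in\mathrm{Hom}(\Lambda_Q,\mathbb Z)$ be a $\sigma$-compatible stability, i.e. $\theta\circ\sigma=-\theta$, and let $\mu(d)=\theta(d)/\sum_i d_i$ be the slope of $0\ne d\in\Lambda_Q^+$; the slope of a non-zero representation is that of its dimension vector. A self-dual representation is a finite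 dimensional $k$-representation $M$ of $Q$ with a non-degenerate bilinear form on $\bigoplus_i M_i$ such that $M_i\perp M_j$ unless $i=\sigma(j)$, the form is $s_i$-symmetric on $M_i+M_{\sigma(i)}$, and $\langle m_\alpha x,x'\rangle=\tau_\alpha\langle x,m_{\sigma(\alpha)}x'\rangle$ for $\alpha:i\to j$, $x\in M_i$, $x'\in M_{\sigma(j)}$. For an isotropic subrepresentation $U\subset M$ let $M/\!/U=U^\perp/U$ with the induced form. A representation $U$ is semistable if $\mu(V)\le\mu(U)$ for all non-zero subrepresentations $V\subsetneq U$. A self-dual representation $M$ is semistable if $\mu(V)\le\mu(M)$ for all non-zero isotropic subrepresentations $V\subset M$ (so the zero one is semistable). The Hall algebra $\mathcal H_Q$ is the $\mathbb Q$-vector space on isomorphism classes $[U]$ of representations with product $[U]\cdot[V]=\sum_X\#\{\tilde U\subset X\mid\tilde U\simeq U,\ X/\tilde U\simeq V\}\,[X]$ and unit $[0]$. The Hall module $\mathcal M_Q$ is the $\mathbb Q$-vector space on isometry classes $[M]$ of self-dual representations with action $[U]\star[M]=\sum_N\#\{\tilde U\subset N\text{ isotropic}\mid\tilde U\simeq U,\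 N/\!/\tilde U\simeq_S M\}\,[N]$, where $\simeq_S$ denotes isometry. Let $\mathbf 1_d,\mathbf 1_d^\theta\in\mathcal H_Q$ be the sums of $[U]$ over all, respectively all semistable, isomorphism classes of dimension vector $d$, and let $\mathbf 1_d^\sigma,\mathbf 1_d^{\sigma,\theta}\in\mathcal M_Q$ be the sums of $[M]$ over all, respectively all semistable, isometry classes of self-dual representations of dimension vector $d$. Theorem. Let $d\in\Lambda_Q^{\sigma,+}$. The self-dual Harder–Narasimhan recursion $$\mathbf 1_d^\sigma=\sum_{(d^\bullet;d^\infty)}\mathbf 1^\theta_{d^1}\cdots\mathbf 1^\theta_{d^n}\star\mathbf 1^{\sigma,\theta}_{d^\infty}$$ holds, the sum being over all $n\ge0$, non-zero $d^1,\dots,d^n\in\Lambda_Q^+$ and $d^\infty\in\Lambda_Q^{\sigma,+}$ (possibly zero) of $\sigma$-weight $\sum_iH(d^i)+d^\infty=d$ with $\mu(d^1)>\cdots>\mu(d^n)>0$; and it is solved by $$\mathbf 1_d^{\sigma,\theta}=\sum_{(d^\bullet;d^\infty)}(-1)^n\,\mathbf 1_{d^1}\cdots\mathbf 1_{d^n}\star\mathbf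 1^\sigma_{d^\infty},$$ the sum being over all $n\ge0$, non-zero $d^1,\dots,d^n\in\Lambda_Q^+$ and $d^\infty\in\Lambda_Q^{\sigma,+}$ such that $(d^\bullet;d^\infty)$ equals $(\varnothing;d)$, or has $\sigma$-weight $d$ and satisfies $\mu(d^1+\cdots+d^j)>0$ for $j=1,\dots,n$. Both sums are finite. -/

import Mathlib

universe u v w

noncomputable section

namespace SelfDualQuiver

/-! ### Quiver representations -/

section Reps

variable (k : Type u) [Field k] (Q : Type v) [Quiver.{w} Q]

/-- A finite dimensional `k`-representation of the quiver `Q`. -/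
structure Rep where
  V : Q → Type u
  [instAddCommGroup : ∀ i, AddCommGroup (V i)]
  [instModule : ∀ i, Module k (V i)]
  [instFinite : ∀ i, FiniteDimensional k (V i)]
  map : ∀ {i j : Q}, (i ⟶ j) → V i →ₗ[k] V j

end Reps

attribute [instance] Rep.instAddCommGroup Rep.instModule Rep.instFinite

section

variable {k : Type u} [Field k] {Q : Type v} [Quiver.{w} Q]

namespace Rep

/-- The dimension vector. -/
def dimVec (U : Rep k Q) : Q → ℕ := fun i => Module.finrank k (U.V i)

/-- An isomorphism of representations. -/
structure Iso (U V : Rep k Q) where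
  equiv : ∀ i, U.V i ≃ₗ[k] V.V i
  comm : ∀ {i j : Q} (a : i ⟶ j) (x : U.V i), equiv j (U.map a x) = V.map a (equiv i x)

/-- The identity isomorphism. -/
def Iso.refl (U : Rep k Q) : Iso U U := ⟨fun _ => LinearEquiv.refl k _, fun _ _ => rfl⟩

/-- The inverse isomorphism. -/
def Iso.symm {U V : Rep k Q} (e : Iso U V) : Iso V U where
  equiv i := (e.equiv i).symm
  comm {i j} a x := by
    rw [LinearEquiv.symm_apply_eq, e.comm, LinearEquiv.apply_symm_apply]

/-- The composite isomorphism. -/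
def Iso.trans {U V W : Rep k Q} (e : Iso U V) (f : Iso V W) : Iso U W where
  equiv i := (e.equiv i).trans (f.equiv i)
  comm {i j} a x := by simp [e.comm, f.comm]

theorem Iso.dimVec_eq {U V : Rep k Q} (e : Iso U V) : U.dimVec = V.dimVec :=
  funext fun i => (e.equiv i).finrank_eq

instance isoSetoid : Setoid (Rep k Q) where
  r U V := Nonempty (Iso U V)
  iseqv := ⟨fun U => ⟨Iso.refl U⟩, fun ⟨e⟩ => ⟨e.symm⟩, fun ⟨e⟩ ⟨f⟩ => ⟨e.trans f⟩⟩

/-- A subrepresentation. -/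
@[ext]
structure SubRep (U : Rep k Q) where
  sub : ∀ i, Submodule k (U.V i)
  map_mem : ∀ {i j : Q} (a : i ⟶ j), ∀ x ∈ sub i, U.map a x ∈ sub j

/-- A subrepresentation, regarded as a representation. -/
def SubRep.toRep {U : Rep k Q} (W : U.SubRep) : Rep k Q where
  V i := W.sub i
  map {_ _} a := (U.map a).restrict (W.map_mem a)

/-- The quotient of a representation by a subrepresentation. -/
def SubRep.quot {U : Rep k Q} (W : U.SubRep) : Rep k Q where
  V i := U.V i ⧸ W.sub i
  map {i j} a := (W.sub i).mapQ (W.sub j) (U.map a) (W.map_mem a)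

/-- The zero representation. -/
def zero (k : Type u) [Field k] (Q : Type v) [Quiver.{w} Q] : Rep k Q where
  V _ := PUnit.{u + 1}
  map _ := 0

end Rep

variable (k Q) in
/-- Isomorphism classes of representations. -/
def IsoClass := Quotient (Rep.isoSetoid (k := k) (Q := Q))

/-- The isomorphism class of a representation. -/
def Rep.cls (U : Rep k Q) : IsoClass k Q := Quotient.mk _ U

/-- A representative of an isomorphism class. -/
def IsoClass.out (c : IsoClass k Q) : Rep k Q := Quotient.out c

theorem IsoClass.cls_out (c : IsoClass k Q) : c.out.cls = c := Quotient.out_eq c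

/-- The dimension vector of an isomorphism class. -/
def IsoClass.dimVec (c : IsoClass k Q) : Q → ℕ := c.out.dimVec

theorem Rep.cls_eq_iff {U V : Rep k Q} : U.cls = V.cls ↔ Nonempty (U.Iso V) :=
  Quotient.eq (r := Rep.isoSetoid)

theorem Rep.dimVec_cls (U : Rep k Q) : U.cls.dimVec = U.dimVec := by
  obtain ⟨e⟩ := Rep.cls_eq_iff.1 U.cls.cls_out
  exact e.dimVec_eq

theorem Rep.SubRep.dimVec_add {U : Rep k Q} (W : U.SubRep) :
    U.dimVec = W.toRep.dimVec + W.quot.dimVec := by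
  funext i
  have h := Submodule.finrank_quotient_add_finrank (W.sub i)
  simp only [Rep.dimVec, Pi.add_apply]
  rw [← h, add_comm]
  rfl

/-! ### Stability -/

/-- The slope `θ(d) / dim d` of a (non-zero) dimension vector. -/
def slope [Fintype Q] (θ : (Q → ℤ) →+ ℤ) (d : Q → ℕ) : ℚ :=
  (θ (fun i => (d i : ℤ)) : ℚ) / ((∑ i, d i : ℕ) : ℚ)

/-- `U` is semistable: `μ(W) ≤ μ(U)` for all non-zero `W ⊊ U`. -/
def Rep.IsSemistable [Fintype Q] (U : Rep k Q) (θ : (Q → ℤ) →+ ℤ) : Prop :=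
  ∀ W : U.SubRep, (∃ i, W.sub i ≠ ⊥) → (∃ i, W.sub i ≠ ⊤) →
    slope θ W.toRep.dimVec ≤ slope θ U.dimVec

/-! ### Quivers with involution, duality structures -/

variable (Q) in
/-- A contravariant involution of a quiver; `Quiver.Total Q` is the type of all arrows of `Q`. -/
structure QuiverInvolution where
  node : Q → Q
  arrow : Quiver.Total Q → Quiver.Total Q
  node_node : ∀ i, node (node i) = i
  arrow_arrow : ∀ a, arrow (arrow a) = a
  arrow_left : ∀ a, (arrow a).left = node a.right
  arrow_right : ∀ a, (arrow a).right = node a.left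
  arrow_fixed : ∀ a : Quiver.Total Q, a.right = node a.left → arrow a = a

/-- A duality structure `(s, τ)` on `(Q, σ)`. -/
structure DualityStructure (σ : QuiverInvolution Q) where
  s : Q → ℤˣ
  τ : Quiver.Total Q → ℤˣ
  s_node : ∀ i, s (σ.node i) = s i
  τ_mul : ∀ a : Quiver.Total Q, τ a * τ (σ.arrow a) = s a.left * s a.right

/-- The stability `θ` is `σ`-compatible: `σ^* θ = -θ`. -/
def IsCompatible (σ : QuiverInvolution Q) (θ : (Q → ℤ) →+ ℤ) : Prop :=
  ∀ x : Q → ℤ, θ (fun i => x (σ.node i)) = -θ x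

/-- The dimension vector `d` is `σ`-invariant. -/
def IsInvariant (σ : QuiverInvolution Q) (d : Q → ℕ) : Prop :=
  ∀ i, d (σ.node i) = d i

/-- The map `H(d) = d + σ(d)`. -/
def hyp (σ : QuiverInvolution Q) (d : Q → ℕ) : Q → ℕ := fun i => d i + d (σ.node i)

variable {σ : QuiverInvolution Q}

variable (k) in
/-- A self-dual representation. The bilinear form on the total space `⨁ i, M_i` is given by its
components `form i j : M_i × M_j → k`. Because of `form_orth`, the condition `nondeg` says that the
form on the total space is non-degenerate. -/
structure SDRep (D : DualityStructure σ) where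
  rep : Rep k Q
  form : ∀ i j : Q, rep.V i →ₗ[k] rep.V j →ₗ[k] k
  form_orth : ∀ i j : Q, i ≠ σ.node j → form i j = 0
  form_symm : ∀ (i : Q) (x : rep.V i) (y : rep.V (σ.node i)),
    form i (σ.node i) x y = ((D.s i : ℤ) : k) * form (σ.node i) i y x
  form_map : ∀ (a : Quiver.Total Q) (x : rep.V a.left) (y : rep.V (σ.arrow a).left),
    form a.right (σ.arrow a).left (rep.map a.hom x) y -
      ((D.τ a : ℤ) : k) * form a.left (σ.arrow a).right x (rep.map (σ.arrow a).hom y) = 0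
  nondeg : ∀ (i : Q) (x : rep.V i), (∀ (j : Q) (y : rep.V j), form i j x y = 0) → x = 0

namespace SDRep

variable {D : DualityStructure σ}

/-- The dimension vector of the underlying representation. -/
def dimVec (M : SDRep k D) : Q → ℕ := M.rep.dimVec

/-- An isometry of self-dual representations. -/
structure Isometry (M N : SDRep k D) where
  iso : M.rep.Iso N.rep
  form_eq : ∀ (i j : Q) (x : M.rep.V i) (y : M.rep.V j),
    N.form i j (iso.equiv i x) (iso.equiv j y) = M.form i j x y

instance isometrySetoid : Setoid (SDRep k D) where
  r M N := Nonempty (Isometry M N)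
  iseqv := ⟨fun M => ⟨Rep.Iso.refl _, fun _ _ _ _ => rfl⟩,
    fun {M N} ⟨e⟩ => ⟨e.iso.symm, fun i j x y => by
      rw [← e.form_eq]
      simp [Rep.Iso.symm]⟩,
    fun {M N P} ⟨e⟩ ⟨f⟩ => ⟨e.iso.trans f.iso, fun i j x y => by
      rw [← e.form_eq, ← f.form_eq]
      rfl⟩⟩

theorem form_swap_eq_zero (M : SDRep k D) {i j : Q} {x : M.rep.V i} {y : M.rep.V j}
    (h : M.form i j x y = 0) : M.form j i y x = 0 := by
  by_cases hj : j = σ.node i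
  · subst hj
    have h1 := M.form_symm i x y
    rw [h] at h1
    rcases mul_eq_zero.1 h1.symm with h2 | h2
    · rcases Int.units_eq_one_or (D.s i) with h3 | h3 <;> simp [h3] at h2
    · exact h2
  · rw [M.form_orth j i hj]
    rfl

/-- The orthogonal `W^⊥` of a subrepresentation. -/
def perp (M : SDRep k D) (W : M.rep.SubRep) : M.rep.SubRep where
  sub i :=
    { carrier := {x | ∀ (j : Q), ∀ y ∈ W.sub j, M.form i j x y = 0}
      add_mem' := fun hx hy j z hz => by simp [hx j z hz, hy j z hz]
      zero_mem' := fun j z _ => by simp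
      smul_mem' := fun c x hx j z hz => by simp [hx j z hz] }
  map_mem {i j} a x hx l y hy := by
    by_cases hl : j = σ.node l
    · have h1 : (σ.arrow ⟨i, j, a⟩).left = σ.node j := σ.arrow_left ⟨i, j, a⟩
      have h2 : l = (σ.arrow ⟨i, j, a⟩).left :=
        (h1.trans ((congrArg σ.node hl).trans (σ.node_node l))).symm
      subst h2
      have h3 := M.form_map ⟨i, j, a⟩ x y
      rw [sub_eq_zero] at h3
      refine h3.trans ?_
      have h4 := hx _ _ (W.map_mem (σ.arrow ⟨i, j, a⟩).hom y hy)
      exact mul_eq_zero_of_right _ h4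
    · rw [M.form_orth _ _ hl]
      rfl

/-- The subrepresentation `W` is isotropic: `W ⊆ W^⊥`. -/
def IsIsotropic (M : SDRep k D) (W : M.rep.SubRep) : Prop :=
  ∀ i, W.sub i ≤ (M.perp W).sub i

/-- An element orthogonal to `W^⊥` lies in `W`. -/
theorem mem_of_forall_perp (M : SDRep k D) (W : M.rep.SubRep) (i : Q) (x : M.rep.V i)
    (h : ∀ (j : Q), ∀ y ∈ (M.perp W).sub j, M.form i j x y = 0) : x ∈ W.sub i := by
  by_contra hx
  obtain ⟨f, hf, hW⟩ := Submodule.exists_le_ker_of_notMem hx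
  have inj (i j : Q) (hij : i = σ.node j) : Function.Injective (M.form i j) := by
    rw [injective_iff_map_eq_zero]
    intro z hz
    refine M.nondeg i z fun l y => ?_
    by_cases hl : i = σ.node l
    · have : j = l := by rw [← σ.node_node j, ← hij, hl, σ.node_node]
      subst this
      rw [hz]
      rfl
    · rw [M.form_orth _ _ hl]
      rfl
  have h1 := inj i (σ.node i) (σ.node_node i).symm
  have h2 := inj (σ.node i) i rfl
  have d1 := LinearMap.finrank_le_finrank_of_injective h1
  have d2 := LinearMap.finrank_le_finrank_of_injective h2
  rw [Subspace.dual_finrank_eq (K := k)] at d1 d2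
  have surj : Function.Surjective (M.form (σ.node i) i) := by
    have h3 : Module.finrank k (M.rep.V (σ.node i)) = Module.finrank k (Module.Dual k (M.rep.V i)) := by
      rw [Subspace.dual_finrank_eq]
      exact le_antisymm d2 d1
    exact (LinearMap.injective_iff_surjective_of_finrank_eq_finrank h3).1 h2
  obtain ⟨y, hy⟩ := surj f
  have hyp' : y ∈ (M.perp W).sub (σ.node i) := by
    intro j z hz
    by_cases hj : σ.node i = σ.node j
    · have : i = j := by rw [← σ.node_node i, hj, σ.node_node]
      subst this
      rw [hy]
      exact hW hz
    · rw [M.form_orth _ _ hj]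
      rfl
  apply hf
  rw [← hy]
  exact M.form_swap_eq_zero (h _ y hyp')

/-- The form on `W^⊥ / (W ∩ W^⊥)` induced by the form of `M`. -/
def reductionForm (M : SDRep k D) (W : M.rep.SubRep) (i j : Q) :
    ((M.perp W).sub i ⧸ (W.sub i).submoduleOf ((M.perp W).sub i)) →ₗ[k]
      ((M.perp W).sub j ⧸ (W.sub j).submoduleOf ((M.perp W).sub j)) →ₗ[k] k :=
  Submodule.liftQ _
    (LinearMap.flip
      (Submodule.liftQ _
        (LinearMap.flip ((M.form i j).domRestrict₁₂ ((M.perp W).sub i) ((M.perp W).sub j)))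
        (fun y hy => LinearMap.ext fun x => x.2 j y hy)))
    (fun x hx => by
      rw [LinearMap.mem_ker]
      refine LinearMap.ext fun y => ?_
      induction y using Submodule.Quotient.induction_on with
      | H y => exact M.form_swap_eq_zero (y.2 i x hx))

/-- The underlying representation of `M // W`. -/
def reductionRep (M : SDRep k D) (W : M.rep.SubRep) : Rep k Q where
  V i := (M.perp W).sub i ⧸ (W.sub i).submoduleOf ((M.perp W).sub i)
  map {_ _} a := Submodule.mapQ _ _ ((M.rep.map a).restrict ((M.perp W).map_mem a))
    (fun x hx => W.map_mem a x hx)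

/-- The self-dual quotient `M // W = W^⊥ / W` of `M` by an isotropic subrepresentation `W`.
(For arbitrary `W` this is `W^⊥ / (W ∩ W^⊥)`.) -/
def reduction (M : SDRep k D) (W : M.rep.SubRep) : SDRep k D where
  rep := M.reductionRep W
  form := M.reductionForm W
  form_orth i j hij := by
    refine LinearMap.ext fun x => LinearMap.ext fun y => ?_
    induction x using Submodule.Quotient.induction_on with
    | H x =>
      induction y using Submodule.Quotient.induction_on with
      | H y =>
        change M.form i j x y = 0
        rw [M.form_orth i j hij]
        rfl
  form_symm i x y := by
    induction x using Submodule.Quotient.induction_on with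
    | H x =>
      induction y using Submodule.Quotient.induction_on with
      | H y => exact M.form_symm i x y
  form_map a x y := by
    induction x using Submodule.Quotient.induction_on with
    | H x =>
      induction y using Submodule.Quotient.induction_on with
      | H y => exact M.form_map a x y
  nondeg i x h := by
    induction x using Submodule.Quotient.induction_on with
    | H x =>
      refine (Submodule.Quotient.mk_eq_zero _).2 ?_
      exact M.mem_of_forall_perp W i x fun j y hy => h j (Submodule.Quotient.mk ⟨y, hy⟩)

/-- `M` is `σ`-semistable: `μ(W) ≤ μ(M)` for all non-zero isotropic subrepresentations `W`. -/
def IsSemistable [Fintype Q] (M : SDRep k D) (θ : (Q → ℤ) →+ ℤ) : Prop :=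
  ∀ W : M.rep.SubRep, (∃ i, W.sub i ≠ ⊥) → M.IsIsotropic W →
    slope θ W.toRep.dimVec ≤ slope θ M.dimVec

end SDRep

variable (k) in
/-- Isometry classes of self-dual representations. -/
def IsometryClass (D : DualityStructure σ) := Quotient (SDRep.isometrySetoid (k := k) (D := D))

variable {D : DualityStructure σ}

/-- The isometry class of a self-dual representation. -/
def SDRep.cls (M : SDRep k D) : IsometryClass k D := Quotient.mk _ M

/-- A representative of an isometry class. -/
def IsometryClass.out (c : IsometryClass k D) : SDRep k D := Quotient.out c

theorem IsometryClass.cls_out (c : IsometryClass k D) : c.out.cls = c := Quotient.out_eq c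

theorem SDRep.cls_eq_iff {M N : SDRep k D} : M.cls = N.cls ↔ Nonempty (M.Isometry N) :=
  Quotient.eq (r := SDRep.isometrySetoid)

/-- The dimension vector of an isometry class. -/
def IsometryClass.dimVec (c : IsometryClass k D) : Q → ℕ := c.out.dimVec

theorem SDRep.dimVec_cls (M : SDRep k D) : M.cls.dimVec = M.dimVec := by
  obtain ⟨e⟩ := SDRep.cls_eq_iff.1 M.cls.cls_out
  exact e.iso.dimVec_eq

/-- An upper bound for the dimension vector of `N` in terms of those of `W` and `N // W`. -/
theorem SDRep.dimVec_le (N : SDRep k D) (W : N.rep.SubRep) :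
    N.dimVec ≤ hyp σ W.toRep.dimVec + (N.reduction W).dimVec := by
  intro i
  let P := (N.perp W).sub i
  let f : N.rep.V i →ₗ[k] Module.Dual k (W.sub (σ.node i)) :=
    (N.form i (σ.node i)).domRestrict₁₂ ⊤ (W.sub (σ.node i)) ∘ₗ
      (LinearEquiv.ofTop ⊤ rfl).symm.toLinearMap
  have hker : LinearMap.ker f ≤ P := by
    intro x hx j y hy
    by_cases hj : i = σ.node j
    · have : j = σ.node i := by rw [hj, σ.node_node]
      subst this
      exact LinearMap.congr_fun (LinearMap.mem_ker.1 hx) ⟨y, hy⟩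
    · rw [N.form_orth _ _ hj]
      rfl
  have h1 := LinearMap.finrank_range_add_finrank_ker f
  have h2 := Submodule.finrank_le (LinearMap.range f)
  rw [Subspace.dual_finrank_eq (K := k)] at h2
  have h3 := Submodule.finrank_mono hker
  have h4 := Submodule.finrank_quotient_add_finrank ((W.sub i).submoduleOf P)
  have h5 : Module.finrank k ((W.sub i).submoduleOf P) ≤ Module.finrank k (W.sub i) := by
    let g : (W.sub i).submoduleOf P →ₗ[k] W.sub i :=
      (P.subtype ∘ₗ ((W.sub i).submoduleOf P).subtype).codRestrict (W.sub i) (fun x => x.2)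
    refine LinearMap.finrank_le_finrank_of_injective (f := g) fun x y hxy => ?_
    exact Subtype.ext (Subtype.ext (congrArg (fun z : W.sub i => (z : N.rep.V i)) hxy))
  change Module.finrank k (N.rep.V i) ≤
    Module.finrank k (W.sub i) + Module.finrank k (W.sub (σ.node i)) +
      Module.finrank k (P ⧸ (W.sub i).submoduleOf P)
  omega

/-! ### Finiteness over a finite field -/

section Finiteness

variable [Finite k] [Finite (Quiver.Total Q)]

instance finite_linearMap {V W : Type*} [AddCommGroup V] [Module k V] [FiniteDimensional k V]
    [AddCommGroup W] [Module k W] [FiniteDimensional k W] : Finite (V →ₗ[k] W) :=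
  Module.finite_of_finite k

/-- Coordinates on a representation of dimension vector `d`. -/
def Rep.coord (U : Rep k Q) {d : Q → ℕ} (h : U.dimVec = d) (i : Q) : U.V i ≃ₗ[k] (Fin (d i) → k) :=
  LinearEquiv.ofFinrankEq _ _ (by rw [Module.finrank_fin_fun, ← h]; rfl)

/-- The structure maps in coordinates. -/
def Rep.coordMap (U : Rep k Q) {d : Q → ℕ} (h : U.dimVec = d) (a : Quiver.Total Q) :
    (Fin (d a.left) → k) →ₗ[k] (Fin (d a.right) → k) :=
  (U.coord h a.right).toLinearMap ∘ₗ U.map a.hom ∘ₗ (U.coord h a.left).symm.toLinearMap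

/-- The form in coordinates. -/
def SDRep.coordForm (M : SDRep k D) {d : Q → ℕ} (h : M.rep.dimVec = d) (i j : Q) :
    (Fin (d i) → k) →ₗ[k] (Fin (d j) → k) →ₗ[k] k :=
  (M.form i j).compl₁₂ (M.rep.coord h i).symm.toLinearMap (M.rep.coord h j).symm.toLinearMap

/-- Representations with the same structure maps in coordinates are isomorphic. -/
def Rep.isoOfCoord {U V : Rep k Q} {d : Q → ℕ} (hU : U.dimVec = d) (hV : V.dimVec = d)
    (h : U.coordMap hU = V.coordMap hV) : U.Iso V where
  equiv i := (U.coord hU i).trans (V.coord hV i).symm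
  comm {i j} a x := by
    have h1 := LinearMap.congr_fun (congrFun h ⟨i, j, a⟩) (U.coord hU i x)
    simp only [Rep.coordMap, LinearMap.comp_apply, LinearEquiv.coe_coe,
      LinearEquiv.symm_apply_apply] at h1
    simp [h1]

/-- There are finitely many isomorphism classes of representations of given dimension vector. -/
theorem finite_dimVec_eq (d : Q → ℕ) : {c : IsoClass k Q | c.dimVec = d}.Finite := by
  let F : {c : IsoClass k Q | c.dimVec = d} →
      ∀ a : Quiver.Total Q, (Fin (d a.left) → k) →ₗ[k] (Fin (d a.right) → k) :=
    fun c => c.1.out.coordMap c.2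
  have : Finite {c : IsoClass k Q | c.dimVec = d} := Finite.of_injective F fun c e h => by
    refine Subtype.ext ?_
    rw [← c.1.cls_out, ← e.1.cls_out]
    exact Rep.cls_eq_iff.2 ⟨Rep.isoOfCoord c.2 e.2 h⟩
  exact Set.toFinite _

/-- There are finitely many isometry classes of self-dual representations of given dimension
vector. -/
theorem finite_sd_dimVec_eq [Finite Q] (d : Q → ℕ) : {c : IsometryClass k D | c.dimVec = d}.Finite := by
  let F : {c : IsometryClass k D | c.dimVec = d} →
      (∀ a : Quiver.Total Q, (Fin (d a.left) → k) →ₗ[k] (Fin (d a.right) → k)) ×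
        (∀ i j : Q, (Fin (d i) → k) →ₗ[k] (Fin (d j) → k) →ₗ[k] k) :=
    fun c => (c.1.out.rep.coordMap c.2, c.1.out.coordForm c.2)
  have : Finite {c : IsometryClass k D | c.dimVec = d} := Finite.of_injective F fun c e h => by
    refine Subtype.ext ?_
    rw [← c.1.cls_out, ← e.1.cls_out]
    refine SDRep.cls_eq_iff.2 ⟨Rep.isoOfCoord c.2 e.2 (congrArg Prod.fst h), fun i j x y => ?_⟩
    have h1 := LinearMap.congr_fun (LinearMap.congr_fun (congrFun (congrFun (congrArg Prod.snd h) i) j)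
      (c.1.out.rep.coord c.2 i x)) (c.1.out.rep.coord c.2 j y)
    simp only [F, SDRep.coordForm, LinearMap.compl₁₂_apply, LinearEquiv.coe_coe,
      LinearEquiv.symm_apply_apply] at h1
    exact h1.symm
  exact Set.toFinite _

/-- A representation over a finite field has finitely many subrepresentations. -/
instance Rep.SubRep.finite [Finite Q] (U : Rep k Q) : Finite U.SubRep := by
  have (i : Q) : Finite (U.V i) := Module.finite_of_finite k
  have (i : Q) : Finite (Submodule k (U.V i)) :=
    Finite.of_injective (fun W => (W : Set (U.V i))) SetLike.coe_injective
  exact Finite.of_injective (fun W : U.SubRep => W.sub) fun _ _ h => Rep.SubRep.ext h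

/-! ### Hall algebra and Hall module -/

/-- The Hall number `F^X_{U,V}`: the number of `W ⊆ X` with `W ≃ U` and `X / W ≃ V`. -/
def hallNumber (X : Rep k Q) (U V : IsoClass k Q) : ℕ :=
  Nat.card {W : X.SubRep // W.toRep.cls = U ∧ W.quot.cls = V}

/-- The self-dual Hall number `G^N_{U,M}`: the number of isotropic `W ⊆ N` with `W ≃ U` and
`N // W` isometric to `M`. -/
def sdHallNumber (N : SDRep k D) (U : IsoClass k Q) (M : IsometryClass k D) : ℕ :=
  Nat.card {W : N.rep.SubRep // N.IsIsotropic W ∧ W.toRep.cls = U ∧ (N.reduction W).cls = M}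

theorem finite_hallNumber (U V : IsoClass k Q) :
    (Function.support fun X : IsoClass k Q => (hallNumber X.out U V : ℚ)).Finite := by
  refine (finite_dimVec_eq (k := k) (U.dimVec + V.dimVec)).subset fun X hX => ?_
  have h : hallNumber X.out U V ≠ 0 := fun h => hX (by simp [h])
  obtain ⟨⟨W, rfl, rfl⟩⟩ := (Nat.card_ne_zero.1 h).1
  rw [Set.mem_ofPred_eq, Rep.dimVec_cls, Rep.dimVec_cls]
  exact W.dimVec_add

theorem finite_sdHallNumber [Finite Q] (U : IsoClass k Q) (M : IsometryClass k D) :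
    (Function.support fun N : IsometryClass k D => (sdHallNumber N.out U M : ℚ)).Finite := by
  cases nonempty_fintype Q
  classical
  refine ((Set.finite_Iic (hyp σ U.dimVec + M.dimVec)).biUnion fun d _ =>
    finite_sd_dimVec_eq (k := k) (D := D) d).subset fun N hN => ?_
  have h : sdHallNumber N.out U M ≠ 0 := fun h => hN (by simp [h])
  obtain ⟨⟨W, -, rfl, rfl⟩⟩ := (Nat.card_ne_zero.1 h).1
  refine Set.mem_biUnion (x := N.dimVec) ?_ rfl
  rw [Rep.dimVec_cls, SDRep.dimVec_cls]
  exact N.out.dimVec_le W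

end Finiteness

variable (k Q) in
/-- The underlying `ℚ`-vector space of the Hall algebra, with basis the symbols `[U]`. -/
def HallAlgebra := IsoClass k Q →₀ ℚ

variable (k D) in
/-- The underlying `ℚ`-vector space of the Hall module, with basis the symbols `[M]`. -/
def HallModule := IsometryClass k D →₀ ℚ

instance : AddCommGroup (HallAlgebra k Q) := inferInstanceAs (AddCommGroup (IsoClass k Q →₀ ℚ))
instance : Module ℚ (HallAlgebra k Q) := inferInstanceAs (Module ℚ (IsoClass k Q →₀ ℚ))
instance : AddCommGroup (HallModule k D) :=
  inferInstanceAs (AddCommGroup (IsometryClass k D →₀ ℚ))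
instance : Module ℚ (HallModule k D) := inferInstanceAs (Module ℚ (IsometryClass k D →₀ ℚ))

/-- The basis element `[U]` of the Hall algebra. -/
def HallAlgebra.symbol (c : IsoClass k Q) : HallAlgebra k Q := Finsupp.single c 1

/-- The basis element `[M]` of the Hall module. -/
def HallModule.symbol (c : IsometryClass k D) : HallModule k D := Finsupp.single c 1

section Products

variable [Finite k] [Fintype Q] [Finite (Quiver.Total Q)]

/-- `[U] · [V] = ∑_X F^X_{U,V} [X]`. -/
def HallAlgebra.symbolMul (U V : IsoClass k Q) : HallAlgebra k Q :=
  Finsupp.ofSupportFinite (fun X => (hallNumber X.out U V : ℚ)) (finite_hallNumber U V)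

/-- `[U] ⋆ [M] = ∑_N G^N_{U,M} [N]`. -/
def HallModule.symbolAct (U : IsoClass k Q) (M : IsometryClass k D) : HallModule k D :=
  Finsupp.ofSupportFinite (fun N => (sdHallNumber N.out U M : ℚ)) (finite_sdHallNumber U M)

/-- The unit `[0]` of the Hall algebra. -/
instance : One (HallAlgebra k Q) := ⟨HallAlgebra.symbol (Rep.zero k Q).cls⟩

/-- The bilinear extension of `[U] · [V] = ∑_X F^X_{U,V} [X]`. -/
instance : Mul (HallAlgebra k Q) :=
  ⟨fun f g => Finsupp.sum f fun U a => Finsupp.sum g fun V b => (a * b) • HallAlgebra.symbolMul U V⟩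

/-- The action `f ⋆ m` of the Hall algebra on the Hall module, the bilinear extension of
`[U] ⋆ [M] = ∑_N G^N_{U,M} [N]`. -/
def HallModule.act (f : HallAlgebra k Q) (m : HallModule k D) : HallModule k D :=
  Finsupp.sum f fun U a => Finsupp.sum m fun M b => (a * b) • HallModule.symbolAct U M

end Products

/-! ### Characteristic functions -/

section Characteristic

variable [Finite k] [Fintype Q] [Finite (Quiver.Total Q)]

variable (k) in
/-- The characteristic function `1_d` in the Hall algebra. -/
def charRep (d : Q → ℕ) : HallAlgebra k Q :=
  ∑ c ∈ (finite_dimVec_eq (k := k) d).toFinset, HallAlgebra.symbol c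

open scoped Classical in
variable (k) in
/-- The characteristic function `1_d^θ` of semistable representations. -/
def charRepSS (θ : (Q → ℤ) →+ ℤ) (d : Q → ℕ) : HallAlgebra k Q :=
  ∑ c ∈ (finite_dimVec_eq (k := k) d).toFinset with c.out.IsSemistable θ, HallAlgebra.symbol c

variable (k) in
/-- The characteristic function `1_d^σ` in the Hall module. -/
def charSD (D : DualityStructure σ) (d : Q → ℕ) : HallModule k D :=
  ∑ c ∈ (finite_sd_dimVec_eq (k := k) (D := D) d).toFinset, HallModule.symbol c

open scoped Classical in
variable (k) in
/-- The characteristic function `1_d^{σ,θ}` of semistable self-dual representations. -/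
def charSDSS (D : DualityStructure σ) (θ : (Q → ℤ) →+ ℤ) (d : Q → ℕ) : HallModule k D :=
  ∑ c ∈ (finite_sd_dimVec_eq (k := k) (D := D) d).toFinset with c.out.IsSemistable θ,
    HallModule.symbol c

end Characteristic

/-! ### Index sets of the sums -/

/-- The pairs `(d^1, …, d^n; d^∞)`, `n ≥ 0`, of `σ`-weight `∑ H(d^i) + d^∞ = d`, where the `d^i` are
non-zero dimension vectors and `d^∞` is a `σ`-invariant dimension vector. -/
def weightSet (σ : QuiverInvolution Q) (d : Q → ℕ) : Set (List (Q → ℕ) × (Q → ℕ)) :=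
  {p | (∀ x ∈ p.1, x ≠ 0) ∧ IsInvariant σ p.2 ∧ (p.1.map (hyp σ)).sum + p.2 = d}

theorem finite_weightSet [Finite Q] (σ : QuiverInvolution Q) (d : Q → ℕ) :
    (weightSet σ d).Finite := by
  classical
  cases nonempty_fintype Q
  have key : ∀ l : List (Q → ℕ), (∀ x ∈ l, x ≠ 0) → (l.map (hyp σ)).sum ≤ d →
      (∀ x ∈ l, x ≤ d) ∧ l.length ≤ ∑ i, d i := by
    intro l
    induction l generalizing d with
    | nil => simp
    | cons x l ih =>
      intro h0 h
      rw [List.map_cons, List.sum_cons] at h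
      have hx : x ≤ hyp σ x := fun i => Nat.le_add_right _ _
      have h1 : (l.map (hyp σ)).sum ≤ d - x := fun i => by
        have h2 := h i
        have h3 := hx i
        simp only [Pi.add_apply, Pi.sub_apply] at *
        omega
      have hxd : x ≤ d := fun i => (hx i).trans ((Nat.le_add_right _ _).trans (h i))
      obtain ⟨h4, h5⟩ := ih (d - x) (fun y hy => h0 y (List.mem_cons_of_mem _ hy)) h1
      have h6 : ∃ i, x i ≠ 0 := by
        by_contra hc
        push Not at hc
        exact h0 x List.mem_cons_self (funext hc)
      obtain ⟨i, hi⟩ := h6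
      have h7 : ∑ i, (d - x) i < ∑ i, d i := by
        refine Finset.sum_lt_sum (fun j _ => Nat.sub_le _ _) ⟨i, Finset.mem_univ _, ?_⟩
        have h8 : x i ≤ d i := hxd i
        have h9 : (d - x) i = d i - x i := rfl
        omega
      refine ⟨fun y hy => ?_, ?_⟩
      · rcases List.mem_cons.1 hy with rfl | hy
        · exact hxd
        · exact (h4 y hy).trans fun j => Nat.sub_le _ _
      · rw [List.length_cons]
        omega
  have hfin : Finite (Set.Iic d) := (Set.finite_Iic d).to_subtype
  refine (((List.finite_length_le (Set.Iic d) (∑ i, d i)).image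
    (List.map Subtype.val)).prod (Set.finite_Iic d)).subset ?_
  rintro ⟨l, e⟩ ⟨h0, -, h⟩
  have hl : (l.map (hyp σ)).sum ≤ d := fun i => by rw [← h]; exact Nat.le_add_right _ _
  have he : e ≤ d := fun i => by rw [← h]; exact Nat.le_add_left _ _
  obtain ⟨h1, h2⟩ := key l h0 hl
  refine ⟨⟨l.attachWith (· ∈ Set.Iic d) h1, ?_, ?_⟩, he⟩
  · exact (List.length_attachWith ..).trans_le h2
  · exact List.attachWith_map_subtype_val ..

/-- The range of the Harder–Narasimhan recursion: the slopes of `(d^1, …, d^n; d^∞)` are strictly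
decreasing, the slope of `d^∞` being zero. -/
def hnSet [Fintype Q] (σ : QuiverInvolution Q) (θ : (Q → ℤ) →+ ℤ) (d : Q → ℕ) :
    Set (List (Q → ℕ) × (Q → ℕ)) :=
  {p | p ∈ weightSet σ d ∧ p.1.Pairwise (fun x y => slope θ y < slope θ x) ∧
    ∀ x ∈ p.1, 0 < slope θ x}

/-- The range of the solution of the recursion: `(∅; d)`, and the `(d^1, …, d^n; d^∞)` of
`σ`-weight `d` with `μ(d^1 + ⋯ + d^j) > 0` for `j = 1, …, n`. -/
def solutionSet [Fintype Q] (σ : QuiverInvolution Q) (θ : (Q → ℤ) →+ ℤ) (d : Q → ℕ) :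
    Set (List (Q → ℕ) × (Q → ℕ)) :=
  {p | p = ([], d) ∨
    (p ∈ weightSet σ d ∧ ∀ j, 1 ≤ j → j ≤ p.1.length → 0 < slope θ (p.1.take j).sum)}

theorem finite_hnSet [Fintype Q] (σ : QuiverInvolution Q) (θ : (Q → ℤ) →+ ℤ) (d : Q → ℕ) :
    (hnSet σ θ d).Finite :=
  (finite_weightSet σ d).subset fun _ h => h.1

theorem finite_solutionSet [Fintype Q] (σ : QuiverInvolution Q) (θ : (Q → ℤ) →+ ℤ) (d : Q → ℕ) :
    (solutionSet σ θ d).Finite :=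
  ((Set.finite_singleton ([], d)).union (finite_weightSet σ d)).subset fun _ h =>
    h.imp id fun h => h.1

end

end SelfDualQuiver

end

open SelfDualQuiver

/-! Both identities are compared coefficient by coefficient. By the module law, the coefficient at
[N] of a sum over (d^•; d^∞) counts, with weights, chains 0 < U^1 < ⋯ < U^n of isotropic
subrepresentations of N, and splitting off U^1 leaves a sum of the same kind for N // U^1
(`coeff_weightedSum`). The stability enters through θ(W^⊥) = θ(W). With the modular law this gives
θ(V ∩ U^⊥) + θ(U ∩ V^⊥) = θ(V) + θ(U) (`SDRep.degree_inf_perp`), the substitute for comparing V + U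
with V ∩ U when V + U need not be isotropic.

Recursion: each N has exactly one chain of the required type. If N is not semistable, take the usual
maximal destabilizing subrepresentation U, of largest slope c > 0 and then of largest size. It is
isotropic, because U ∩ U^⊥ has the same degree as U and cannot be smaller without exceeding slope c.
Moreover U is semistable and all non-zero isotropic subrepresentations of N // U have slope less
than c; these properties determine U (`SDRep.exists_isDestabilizing`,
`SDRep.IsDestabilizing.unique`). Induction on the size of N, with an upper bound on the slopes
carried along, finishes the count (`coeff_weightedSum_hnWeight`).

Solution: this does not go through the recursion. The coefficient at [N] is the sum of (-1)^n over
chains in the poset P of isotropic W with θ(W) > 0, that is, minus the reduced Euler characteristic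
of P. If N is semistable, P is empty and the value is 1. Otherwise choose M isotropic with θ(M)
maximal; then V ≥ V ∩ M^⊥ ≤ (V ∩ M^⊥) + M ≥ M is a conical contraction of P and the value is 0
(`sum_eq_one_of_conical`, `solutionCoeff_zero`). -/

noncomputable section

namespace SelfDualQuiver

/-! ### Subrepresentations, orthogonals and self-dual reduction. -/

section Geometry

variable {k : Type u} [Field k] {Q : Type v} [Quiver.{w} Q]

namespace Rep

/-- A bijective morphism of representations is an isomorphism. -/
def Iso.ofBijective {U V : Rep k Q} (f : ∀ i, U.V i →ₗ[k] V.V i)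
    (hf : ∀ i, Function.Bijective (f i))
    (comm : ∀ {i j : Q} (a : i ⟶ j) (x : U.V i), f j (U.map a x) = V.map a (f i x)) :
    U.Iso V where
  equiv i := LinearEquiv.ofBijective (f i) (hf i)
  comm a x := comm a x

namespace SubRep

variable {U : Rep k Q}

instance : PartialOrder U.SubRep := PartialOrder.lift SubRep.sub fun _ _ h => SubRep.ext h

instance : Lattice U.SubRep where
  sup V W := ⟨fun i => V.sub i ⊔ W.sub i, fun {i j} a x hx => by
    obtain ⟨y, hy, z, hz, rfl⟩ := Submodule.mem_sup.1 hx
    rw [map_add]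
    exact Submodule.add_mem_sup (V.map_mem a y hy) (W.map_mem a z hz)⟩
  inf V W := ⟨fun i => V.sub i ⊓ W.sub i, fun a x hx =>
    ⟨V.map_mem a x hx.1, W.map_mem a x hx.2⟩⟩
  le_sup_left _ _ _ := le_sup_left
  le_sup_right _ _ _ := le_sup_right
  sup_le _ _ _ h h' i := sup_le (h i) (h' i)
  inf_le_left _ _ _ := inf_le_left
  inf_le_right _ _ _ := inf_le_right
  le_inf _ _ _ h h' i := le_inf (h i) (h' i)

instance : BoundedOrder U.SubRep where
  top := ⟨fun _ => ⊤, fun _ _ _ => Submodule.mem_top⟩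
  bot := ⟨fun _ => ⊥, fun a x hx => by
    rw [Submodule.mem_bot] at hx ⊢
    rw [hx, map_zero]⟩
  le_top _ _ := le_top
  bot_le _ _ := bot_le

theorem ne_bot_iff {W : U.SubRep} : W ≠ ⊥ ↔ ∃ i, W.sub i ≠ ⊥ := by
  rw [Ne, SubRep.ext_iff, funext_iff, not_forall]
  rfl

theorem ne_top_iff {W : U.SubRep} : W ≠ ⊤ ↔ ∃ i, W.sub i ≠ ⊤ := by
  rw [Ne, SubRep.ext_iff, funext_iff, not_forall]
  rfl

/-- The dimension vector of a subrepresentation. -/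
def dim (W : U.SubRep) : Q → ℕ := W.toRep.dimVec

theorem dim_apply (W : U.SubRep) (i : Q) : W.dim i = Module.finrank k (W.sub i) := rfl

theorem dim_mono {V W : U.SubRep} (h : V ≤ W) : V.dim ≤ W.dim :=
  fun i => Submodule.finrank_mono (h i)

theorem eq_of_le_of_dim_le {V W : U.SubRep} (h : V ≤ W) (h' : W.dim ≤ V.dim) : V = W :=
  SubRep.ext (funext fun i => Submodule.eq_of_le_of_finrank_le (h i) (h' i))

theorem dim_sup_add_dim_inf (V W : U.SubRep) : (V ⊔ W).dim + (V ⊓ W).dim = V.dim + W.dim :=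
  funext fun i => Submodule.finrank_sup_add_finrank_inf_eq (V.sub i) (W.sub i)

theorem dim_bot : (⊥ : U.SubRep).dim = 0 := funext fun i => finrank_bot k (U.V i)

theorem dim_top : (⊤ : U.SubRep).dim = U.dimVec := funext fun i => finrank_top k (U.V i)

theorem dim_eq_zero {W : U.SubRep} : W.dim = 0 ↔ W = ⊥ :=
  ⟨fun h => (eq_of_le_of_dim_le bot_le (by rw [h, dim_bot])).symm, fun h => by rw [h, dim_bot]⟩

theorem dim_le (W : U.SubRep) : W.dim ≤ U.dimVec := dim_top (U := U) ▸ dim_mono le_top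

/-- The image of a subrepresentation under an isomorphism. -/
def transport {U U' : Rep k Q} (e : U.Iso U') (W : U.SubRep) : U'.SubRep where
  sub i := (W.sub i).map (e.equiv i).toLinearMap
  map_mem {i j} a := by
    rintro _ ⟨x, hx, rfl⟩
    exact ⟨U.map a x, W.map_mem a x hx, e.comm a x⟩

theorem mem_transport {U U' : Rep k Q} (e : U.Iso U') (W : U.SubRep) {i : Q} {x : U.V i} :
    e.equiv i x ∈ (W.transport e).sub i ↔ x ∈ W.sub i := by
  refine ⟨?_, fun h => ⟨x, h, rfl⟩⟩
  rintro ⟨y, hy, h⟩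
  rwa [← (e.equiv i).injective h]

theorem transport_symm {U U' : Rep k Q} (e : U.Iso U') (W : U.SubRep) :
    (W.transport e).transport e.symm = W := by
  refine SubRep.ext (funext fun i => Submodule.ext fun x => ?_)
  have h := mem_transport e.symm (W.transport e) (x := e.equiv i x)
  have h' : e.symm.equiv i (e.equiv i x) = x := (e.equiv i).symm_apply_apply x
  rw [h'] at h
  exact h.trans (mem_transport e W)

/-- The bijection of subrepresentations induced by an isomorphism. -/
def transportEquiv {U U' : Rep k Q} (e : U.Iso U') : U.SubRep ≃ U'.SubRep where
  toFun := transport e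
  invFun := transport e.symm
  left_inv := transport_symm e
  right_inv W := transport_symm e.symm W

theorem toRep_transport_cls {U U' : Rep k Q} (e : U.Iso U') (W : U.SubRep) :
    (W.transport e).toRep.cls = W.toRep.cls :=
  Eq.symm (Rep.cls_eq_iff.2 ⟨⟨fun i => (e.equiv i).submoduleMap (W.sub i),
    fun a x => Subtype.ext (e.comm a x.1)⟩⟩)

theorem quot_transport_cls {U U' : Rep k Q} (e : U.Iso U') (W : U.SubRep) :
    (W.transport e).quot.cls = W.quot.cls := by
  refine Eq.symm (Rep.cls_eq_iff.2 ⟨⟨fun i => Submodule.Quotient.equiv (W.sub i)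
    ((W.transport e).sub i) (e.equiv i) rfl, fun {i j} a x => ?_⟩⟩)
  induction x using Submodule.Quotient.induction_on with
  | H x => exact congrArg (Submodule.Quotient.mk (p := (W.transport e).sub j)) (e.comm a x)

/-- A subrepresentation contained in `W` (or its intersection with `W`), as a subrepresentation
of `W`. -/
def restrict (V W : U.SubRep) : W.toRep.SubRep where
  sub i := (V.sub i).submoduleOf (W.sub i)
  map_mem a x hx := V.map_mem a x.1 hx

/-- A subrepresentation of a subrepresentation. -/
def extend {W : U.SubRep} (V : W.toRep.SubRep) : U.SubRep where
  sub i := (V.sub i).map (W.sub i).subtype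
  map_mem {i j} a := by
    rintro _ ⟨x, hx, rfl⟩
    exact ⟨W.toRep.map a x, V.map_mem a x hx, rfl⟩

theorem extend_le {W : U.SubRep} (V : W.toRep.SubRep) : extend V ≤ W := by
  rintro i _ ⟨x, -, rfl⟩
  exact x.2

theorem restrict_extend {W : U.SubRep} (V : W.toRep.SubRep) : (extend V).restrict W = V := by
  refine SubRep.ext (funext fun i => Submodule.ext fun x => ⟨?_, fun h => ⟨x, h, rfl⟩⟩)
  rintro ⟨y, hy, h⟩
  rwa [← Subtype.ext (p := (· ∈ W.sub i)) h]

theorem extend_restrict {V W : U.SubRep} (h : V ≤ W) : extend (V.restrict W) = V := by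
  refine SubRep.ext (funext fun i => Submodule.ext fun x => ⟨?_, fun hx =>
    ⟨⟨x, h i hx⟩, hx, rfl⟩⟩)
  rintro ⟨y, hy, rfl⟩
  exact hy

theorem toRep_restrict_cls {V W : U.SubRep} (h : V ≤ W) :
    (V.restrict W).toRep.cls = V.toRep.cls :=
  Rep.cls_eq_iff.2 ⟨⟨fun i => Submodule.submoduleOfEquivOfLe (h i), fun _ _ => rfl⟩⟩

theorem dim_restrict {V W : U.SubRep} (h : V ≤ W) : (V.restrict W).dim = V.dim := by
  rw [dim, ← Rep.dimVec_cls, toRep_restrict_cls h, Rep.dimVec_cls, dim]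

theorem dim_extend {W : U.SubRep} (V : W.toRep.SubRep) : (extend V).dim = V.dim := by
  rw [← dim_restrict (extend_le V), restrict_extend]

end SubRep

theorem toRep_cls_eq_zero_iff {U : Rep k Q} {W : U.SubRep} :
    W.toRep.cls = (Rep.zero k Q).cls ↔ W = ⊥ := by
  constructor
  · intro h
    rw [← SubRep.dim_eq_zero, SubRep.dim, ← Rep.dimVec_cls, h, Rep.dimVec_cls]
    exact funext fun i => Module.finrank_zero_of_subsingleton (R := k) (M := PUnit.{u + 1})
  · rintro rfl
    refine Rep.cls_eq_iff.2 ⟨Iso.ofBijective (fun i => 0) (fun i => ?_) fun _ _ => rfl⟩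
    have : Subsingleton ((⊥ : U.SubRep).toRep.V i) :=
      inferInstanceAs (Subsingleton (⊥ : Submodule k (U.V i)))
    exact ⟨fun x y _ => Subsingleton.elim x y, fun y => ⟨0, rfl⟩⟩

end Rep

namespace SDRep

variable {σ : QuiverInvolution Q} {D : DualityStructure σ} (N : SDRep k D)

open SelfDualQuiver.Rep

theorem isIsotropic_iff {W : N.rep.SubRep} : N.IsIsotropic W ↔ W ≤ N.perp W := Iff.rfl

/-- Vanishing of the form is a symmetric relation, so V ↦ V^⊥ is an antitone Galois connection; the
double orthogonal and the orthogonal of a sum follow formally. -/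
theorem le_perp_comm {V W : N.rep.SubRep} : V ≤ N.perp W ↔ W ≤ N.perp V :=
  ⟨fun h j y hy i _ hx => N.form_swap_eq_zero (h i hx j y hy),
    fun h j y hy i _ hx => N.form_swap_eq_zero (h i hx j y hy)⟩

theorem perp_perp (W : N.rep.SubRep) : N.perp (N.perp W) = W :=
  le_antisymm (fun i x hx => N.mem_of_forall_perp W i x hx) (N.le_perp_comm.1 le_rfl)

theorem perp_anti {V W : N.rep.SubRep} (h : V ≤ W) : N.perp W ≤ N.perp V :=
  fun _ _ hx j y hy => hx j y (h j hy)

theorem perp_sup (V W : N.rep.SubRep) : N.perp (V ⊔ W) = N.perp V ⊓ N.perp W := by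
  refine le_antisymm (le_inf (N.perp_anti le_sup_left) (N.perp_anti le_sup_right)) ?_
  exact N.le_perp_comm.1 (sup_le (N.le_perp_comm.1 inf_le_left) (N.le_perp_comm.1 inf_le_right))

theorem isIsotropic_bot : N.IsIsotropic ⊥ := N.isIsotropic_iff.2 bot_le

variable {N} in
theorem IsIsotropic.mono {V W : N.rep.SubRep} (hW : N.IsIsotropic W) (h : V ≤ W) :
    N.IsIsotropic V :=
  N.isIsotropic_iff.2 (h.trans ((N.isIsotropic_iff.1 hW).trans (N.perp_anti h)))

variable {N} in
theorem IsIsotropic.sup {V W : N.rep.SubRep} (hV : N.IsIsotropic V) (hW : N.IsIsotropic W)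
    (h : V ≤ N.perp W) : N.IsIsotropic (V ⊔ W) := by
  rw [isIsotropic_iff, perp_sup]
  exact sup_le (le_inf hV h) (le_inf (N.le_perp_comm.1 h) hW)

theorem form_injective (i : Q) (x : N.rep.V i) (h : N.form i (σ.node i) x = 0) : x = 0 := by
  refine N.nondeg i x fun j y => ?_
  by_cases hj : i = σ.node j
  · have : j = σ.node i := by rw [hj, σ.node_node]
    subst this
    rw [h]
    rfl
  · rw [N.form_orth _ _ hj]
    rfl

theorem finrank_node (i : Q) :
    Module.finrank k (N.rep.V (σ.node i)) = Module.finrank k (N.rep.V i) := by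
  have key (i : Q) : Module.finrank k (N.rep.V i) ≤ Module.finrank k (N.rep.V (σ.node i)) := by
    rw [← Subspace.dual_finrank_eq (V := N.rep.V (σ.node i))]
    exact LinearMap.finrank_le_finrank_of_injective (f := N.form i (σ.node i))
      ((injective_iff_map_eq_zero _).2 (N.form_injective i))
  refine le_antisymm ?_ (key i)
  have := key (σ.node i)
  rwa [σ.node_node] at this

theorem dimVec_isInvariant : IsInvariant σ N.dimVec := N.finrank_node

/-- W^⊥ at the node i is the kernel of the map N_i → (W_{σ(i)})^* given by the form, and this map is
onto because N_i is identified with the dual of N_{σ(i)}. -/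
theorem dim_perp_add (W : N.rep.SubRep) (i : Q) :
    (N.perp W).dim i + W.dim (σ.node i) = N.dimVec i := by
  let f : N.rep.V i →ₗ[k] Module.Dual k (W.sub (σ.node i)) :=
    (W.sub (σ.node i)).dualRestrict ∘ₗ N.form i (σ.node i)
  have hker : LinearMap.ker f = (N.perp W).sub i := by
    refine le_antisymm (fun x hx j y hy => ?_) fun x hx => ?_
    · by_cases hj : i = σ.node j
      · have : j = σ.node i := by rw [hj, σ.node_node]
        subst this
        exact LinearMap.congr_fun (LinearMap.mem_ker.1 hx) ⟨y, hy⟩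
      · rw [N.form_orth _ _ hj]
        rfl
    · exact LinearMap.ext fun y => hx _ y.1 y.2
  have hsurj : Function.Surjective f := by
    refine Subspace.dualRestrict_surjective.comp ?_
    refine (LinearMap.injective_iff_surjective_of_finrank_eq_finrank ?_).1
      ((injective_iff_map_eq_zero (N.form i (σ.node i))).2 (N.form_injective i))
    rw [Subspace.dual_finrank_eq, finrank_node]
  have h := LinearMap.finrank_range_add_finrank_ker f
  rw [LinearMap.range_eq_top.2 hsurj, finrank_top, Subspace.dual_finrank_eq, hker] at h
  rw [add_comm]
  exact h

theorem dimVec_reduction {W : N.rep.SubRep} (hW : N.IsIsotropic W) :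
    hyp σ W.dim + (N.reduction W).dimVec = N.dimVec := by
  funext i
  have h1 := N.dim_perp_add W i
  have h2 := Submodule.finrank_quotient_add_finrank ((W.sub i).submoduleOf ((N.perp W).sub i))
  have h3 := (Submodule.submoduleOfEquivOfLe (hW i)).finrank_eq
  have h4 : (N.reduction W).dimVec i =
    Module.finrank k (_ ⧸ (W.sub i).submoduleOf ((N.perp W).sub i)) := rfl
  rw [SubRep.dim_apply] at h1
  rw [Pi.add_apply, hyp, h4, SubRep.dim_apply W i]
  omega

/-- Surjective form preserving maps `W^⊥ → M` induce an isometry `N // W ≃ M`. -/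
def reductionIsometry {W : N.rep.SubRep} (M : SDRep k D)
    (g : ∀ i, (N.perp W).toRep.V i →ₗ[k] M.rep.V i) (hg : ∀ i, Function.Surjective (g i))
    (comm : ∀ {i j : Q} (a : i ⟶ j) (x : (N.perp W).toRep.V i),
      g j ((N.perp W).toRep.map a x) = M.rep.map a (g i x))
    (form_eq : ∀ (i j : Q) (x : (N.perp W).sub i) (y : (N.perp W).sub j),
      M.form i j (g i x) (g j y) = N.form i j x y) : (N.reduction W).Isometry M where
  iso := Rep.Iso.ofBijective
    (fun i => Submodule.liftQ _ (g i) fun x hx => by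
      -- The kernel of g need not be prescribed: an x in W is orthogonal to W^⊥, so g(x) is
      -- orthogonal to all of M by surjectivity and vanishes. Conversely, g(x) = 0 makes x
      -- orthogonal to W^⊥, hence x lies in W^⊥⊥ = W.
      refine M.nondeg i _ fun j y => ?_
      obtain ⟨y, rfl⟩ := hg j y
      exact (form_eq i j x y).trans (N.form_swap_eq_zero (y.2 i x hx)))
    (fun i => by
      refine ⟨(injective_iff_map_eq_zero _).2 fun x hx => ?_, fun y => ?_⟩
      · induction x using Submodule.Quotient.induction_on with
        | H x =>
          refine (Submodule.Quotient.mk_eq_zero _).2 (N.mem_of_forall_perp W i x fun j y hy => ?_)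
          have hx' : g i x = 0 := hx
          rw [← form_eq i j x ⟨y, hy⟩, hx', map_zero]
          rfl
      · obtain ⟨x, rfl⟩ := hg i y
        exact ⟨Submodule.Quotient.mk x, rfl⟩)
    (fun a x => by
      induction x using Submodule.Quotient.induction_on with
      | H x => exact comm a x)
  form_eq i j x y := by
    induction x using Submodule.Quotient.induction_on with
    | H x =>
      induction y using Submodule.Quotient.induction_on with
      | H y => exact form_eq i j x y

theorem reduction_bot_cls : (N.reduction ⊥).cls = N.cls := by
  refine cls_eq_iff.2 ⟨N.reductionIsometry N
    (fun i => ((N.perp ⊥).sub i).subtype) (fun i x => ⟨⟨x, fun j y hy => ?_⟩, rfl⟩)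
    (fun _ _ => rfl) fun _ _ _ _ => rfl⟩
  rw [(Submodule.mem_bot k).1 hy, map_zero]

variable {N} in
theorem perp_transport {N' : SDRep k D} (e : N.Isometry N') (W : N.rep.SubRep) :
    N'.perp (W.transport e.iso) = (N.perp W).transport e.iso := by
  refine SubRep.ext (funext fun i => Submodule.ext fun x => ?_)
  obtain ⟨x, rfl⟩ := (e.iso.equiv i).surjective x
  rw [SubRep.mem_transport]
  constructor
  · intro h j y hy
    rw [← e.form_eq]
    exact h j _ ⟨y, hy, rfl⟩
  · rintro h j _ ⟨y, hy, rfl⟩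
    exact (e.form_eq i j x y).trans (h j y hy)

variable {N} in
theorem isIsotropic_transport {N' : SDRep k D} (e : N.Isometry N') {W : N.rep.SubRep} :
    N'.IsIsotropic (W.transport e.iso) ↔ N.IsIsotropic W := by
  rw [isIsotropic_iff, isIsotropic_iff, perp_transport]
  constructor
  · intro h i x hx
    exact (SubRep.mem_transport e.iso _).1 (h i ⟨x, hx, rfl⟩)
  · rintro h i _ ⟨x, hx, rfl⟩
    exact ⟨x, h i hx, rfl⟩

variable {N} in
theorem reduction_transport_cls {N' : SDRep k D} (e : N.Isometry N') {W : N.rep.SubRep} :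
    (N'.reduction (W.transport e.iso)).cls = (N.reduction W).cls := by
  have mem (i : Q) (x : (N.perp W).sub i) :
      e.iso.equiv i x ∈ (N'.perp (W.transport e.iso)).sub i := by
    rw [perp_transport]
    exact ⟨x, x.2, rfl⟩
  refine (cls_eq_iff.2 ⟨N.reductionIsometry _
    (fun i => Submodule.mkQ _ ∘ₗ ((e.iso.equiv i).toLinearMap.domRestrict _).codRestrict
      ((N'.perp (W.transport e.iso)).sub i) (mem i)) (fun i x => ?_)
      (fun {i j} a x => ?_) fun i j x y => ?_⟩).symm
  · induction x using Submodule.Quotient.induction_on with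
    | H x =>
      obtain ⟨x, hx⟩ := x
      have hx' := hx
      rw [perp_transport] at hx'
      obtain ⟨y, hy, rfl⟩ := hx'
      exact ⟨⟨y, hy⟩, rfl⟩
  · refine congrArg (Submodule.Quotient.mk) (Subtype.ext ?_)
    exact e.iso.comm a x.1
  · exact e.form_eq i j x y

/-- The image in `N // V` of a subrepresentation of `N`. -/
def proj (V W : N.rep.SubRep) : (N.reduction V).rep.SubRep where
  sub i := ((W.sub i).submoduleOf ((N.perp V).sub i)).map
    ((V.sub i).submoduleOf ((N.perp V).sub i)).mkQ
  map_mem {i j} a := by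
    rintro _ ⟨x, hx, rfl⟩
    exact ⟨(N.perp V).toRep.map a x, W.map_mem a x.1 hx, rfl⟩

/-- The preimage in `N` of a subrepresentation of `N // V`. -/
def lift {V : N.rep.SubRep} (W : (N.reduction V).rep.SubRep) : N.rep.SubRep where
  sub i := ((W.sub i).comap ((V.sub i).submoduleOf ((N.perp V).sub i)).mkQ).map
    ((N.perp V).sub i).subtype
  map_mem {i j} a := by
    rintro _ ⟨x, hx, rfl⟩
    exact ⟨(N.perp V).toRep.map a x, W.map_mem a _ hx, rfl⟩

variable {N}

theorem mk_mem_proj {V W : N.rep.SubRep} (h : V ≤ W) {i : Q} {x : (N.perp V).sub i} :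
    (Submodule.Quotient.mk x : (N.reduction V).rep.V i) ∈ (N.proj V W).sub i ↔
      (x : N.rep.V i) ∈ W.sub i := by
  refine ⟨?_, fun hx => ⟨x, hx, rfl⟩⟩
  rintro ⟨y, hy, hyx⟩
  have h1 : y - x ∈ (V.sub i).submoduleOf ((N.perp V).sub i) :=
    (Submodule.Quotient.eq _).1 hyx
  have h2 : (y : N.rep.V i) - x ∈ W.sub i := h i h1
  have h3 : (y : N.rep.V i) ∈ W.sub i := hy
  exact ((W.sub i).sub_mem_iff_right h3).1 h2

theorem mem_lift {V : N.rep.SubRep} {W : (N.reduction V).rep.SubRep} {i : Q}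
    {x : (N.perp V).sub i} : (x : N.rep.V i) ∈ (N.lift W).sub i ↔
      (Submodule.Quotient.mk x : (N.reduction V).rep.V i) ∈ W.sub i := by
  refine ⟨?_, fun hx => ⟨x, hx, rfl⟩⟩
  rintro ⟨y, hy, hyx⟩
  rwa [← Subtype.ext (p := (· ∈ (N.perp V).sub i)) hyx]

theorem lift_le_perp {V : N.rep.SubRep} (W : (N.reduction V).rep.SubRep) :
    N.lift W ≤ N.perp V := by
  rintro i _ ⟨x, -, rfl⟩
  exact x.2

theorem le_lift {V : N.rep.SubRep} (hV : N.IsIsotropic V) (W : (N.reduction V).rep.SubRep) :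
    V ≤ N.lift W := by
  intro i x hx
  refine mem_lift (x := ⟨x, hV i hx⟩) |>.2 ?_
  have : (Submodule.Quotient.mk ⟨x, hV i hx⟩ : (N.reduction V).rep.V i) = 0 :=
    (Submodule.Quotient.mk_eq_zero _).2 hx
  rw [this]
  exact zero_mem _

theorem proj_lift {V : N.rep.SubRep} (hV : N.IsIsotropic V) (W : (N.reduction V).rep.SubRep) :
    N.proj V (N.lift W) = W := by
  refine SubRep.ext (funext fun i => Submodule.ext fun x => ?_)
  induction x using Submodule.Quotient.induction_on with
  | H x => exact (mk_mem_proj (le_lift hV W)).trans mem_lift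

theorem lift_proj {V W : N.rep.SubRep} (h : V ≤ W) (h' : W ≤ N.perp V) :
    N.lift (N.proj V W) = W := by
  refine SubRep.ext (funext fun i => Submodule.ext fun x => ⟨fun hx => ?_, fun hx => ?_⟩)
  · exact (mk_mem_proj h).1 ((mem_lift (x := ⟨x, lift_le_perp _ i hx⟩)).1 hx)
  · exact (mem_lift (x := ⟨x, h' i hx⟩)).2 ((mk_mem_proj h).2 hx)

theorem mk_mem_perp_proj {V W : N.rep.SubRep} (h' : W ≤ N.perp V) {i : Q}
    {x : (N.perp V).sub i} :
    (Submodule.Quotient.mk x : (N.reduction V).rep.V i) ∈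
      ((N.reduction V).perp (N.proj V W)).sub i ↔ (x : N.rep.V i) ∈ (N.perp W).sub i := by
  constructor
  · intro hx j y hy
    exact hx j (Submodule.Quotient.mk ⟨y, h' j hy⟩) ⟨⟨y, h' j hy⟩, hy, rfl⟩
  · rintro hx j _ ⟨y, hy, rfl⟩
    exact hx j y hy

theorem isIsotropic_proj {V W : N.rep.SubRep} (h : V ≤ W) (h' : W ≤ N.perp V) :
    (N.reduction V).IsIsotropic (N.proj V W) ↔ N.IsIsotropic W := by
  constructor
  · intro H i x hx
    exact (mk_mem_perp_proj h').1 (H i ((mk_mem_proj h (x := ⟨x, h' i hx⟩)).2 hx))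
  · intro H i x hx
    induction x using Submodule.Quotient.induction_on with
    | H x => exact (mk_mem_perp_proj h').2 (H i ((mk_mem_proj h).1 hx))

theorem isIsotropic_lift {V : N.rep.SubRep} (hV : N.IsIsotropic V)
    {W : (N.reduction V).rep.SubRep} :
    N.IsIsotropic (N.lift W) ↔ (N.reduction V).IsIsotropic W := by
  rw [← isIsotropic_proj (le_lift hV W) (lift_le_perp W), proj_lift hV]

/-- Reduction in stages: (W/V)^⊥ in N // V is W^⊥/V, and it maps onto the quotient by W/V with the
same form on representatives. -/
theorem reduction_proj_cls {V W : N.rep.SubRep} (h : V ≤ W) (hW : N.IsIsotropic W) :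
    ((N.reduction V).reduction (N.proj V W)).cls = (N.reduction W).cls := by
  have h1 : N.perp W ≤ N.perp V := N.perp_anti h
  have h2 : W ≤ N.perp V := (N.isIsotropic_iff.1 hW).trans h1
  refine (cls_eq_iff.2 ⟨N.reductionIsometry _ (fun i => Submodule.mkQ _ ∘ₗ
    (Submodule.mkQ _ ∘ₗ Submodule.inclusion (h1 i)).codRestrict
      (((N.reduction V).perp (N.proj V W)).sub i)
      (fun x => (mk_mem_perp_proj h2).2 x.2)) (fun i x => ?_)
      (fun {i j} a x => rfl) fun i j x y => rfl⟩).symm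
  induction x using Submodule.Quotient.induction_on with
  | H x =>
    obtain ⟨x, hx⟩ := x
    induction x using Submodule.Quotient.induction_on with
    | H x => exact ⟨⟨x.1, (mk_mem_perp_proj h2).1 hx⟩, rfl⟩

/-- Identifies the two readings of W/V, inside N // V and as a quotient of W; the Hall module meets
the first and the Hall algebra the second. -/
theorem proj_toRep_cls {V W : N.rep.SubRep} (h : V ≤ W) (h' : W ≤ N.perp V) :
    (N.proj V W).toRep.cls = (V.restrict W).quot.cls := by
  let g (i : Q) : W.sub i →ₗ[k] (N.proj V W).sub i :=
    (Submodule.mkQ _ ∘ₗ Submodule.inclusion (h' i)).codRestrict _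
      (fun x => (mk_mem_proj h).2 x.2)
  have hg (i : Q) (x : W.sub i) : g i x = 0 ↔ (x : N.rep.V i) ∈ V.sub i := by
    rw [Subtype.ext_iff]
    exact Submodule.Quotient.mk_eq_zero _
  refine (Rep.cls_eq_iff.2 ⟨Rep.Iso.ofBijective
    (fun i => Submodule.liftQ _ (g i) fun x hx => (hg i x).2 hx) (fun i => ⟨?_, ?_⟩)
    fun {i j} a x => ?_⟩).symm
  · refine (injective_iff_map_eq_zero _).2 fun x hx => ?_
    induction x using Submodule.Quotient.induction_on with
    | H x => exact (Submodule.Quotient.mk_eq_zero _).2 ((hg i x).1 hx)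
  · rintro ⟨x, hx⟩
    induction x using Submodule.Quotient.induction_on with
    | H x => exact ⟨Submodule.Quotient.mk ⟨x.1, (mk_mem_proj h).1 hx⟩, rfl⟩
  · induction x using Submodule.Quotient.induction_on with
    | H x => rfl

theorem dim_proj {V W : N.rep.SubRep} (h : V ≤ W) (h' : W ≤ N.perp V) :
    V.dim + (N.proj V W).dim = W.dim := by
  rw [SubRep.dim, SubRep.dim, SubRep.dim, ← Rep.dimVec_cls (N.proj V W).toRep,
    proj_toRep_cls h h', Rep.dimVec_cls, ← Rep.dimVec_cls V.toRep, ← SubRep.toRep_restrict_cls h,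
    Rep.dimVec_cls]
  exact (SubRep.dimVec_add _).symm

theorem proj_eq_bot_iff {V W : N.rep.SubRep} (h : V ≤ W) (h' : W ≤ N.perp V) :
    N.proj V W = ⊥ ↔ W = V := by
  rw [← SubRep.dim_eq_zero]
  have h1 := dim_proj h h'
  constructor
  · intro h2
    rw [h2, add_zero] at h1
    exact (SubRep.eq_of_le_of_dim_le h h1.ge).symm
  · rintro rfl
    simpa using h1

end SDRep

end Geometry

/-! ### Coefficients in the Hall algebra and the Hall module; the module laws. -/

section Hall

variable {k : Type u} [Field k] {Q : Type v} [Quiver.{w} Q] {σ : QuiverInvolution Q}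
  {D : DualityStructure σ}

/-- The coefficient of a basis element, as a linear form on the Hall algebra. -/
def HallAlgebra.coeff (c : IsoClass k Q) : HallAlgebra k Q →ₗ[ℚ] ℚ := Finsupp.lapply c

/-- The coefficient of a basis element, as a linear form on the Hall module. -/
def HallModule.coeff (c : IsometryClass k D) : HallModule k D →ₗ[ℚ] ℚ := Finsupp.lapply c

theorem HallAlgebra.coeff_symbol [DecidableEq (IsoClass k Q)] (c e : IsoClass k Q) :
    HallAlgebra.coeff c (HallAlgebra.symbol e) = if e = c then 1 else 0 := by
  refine Eq.trans ?_ (Finsupp.single_apply (a := e) (a' := c) (b := (1 : ℚ)))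
  rfl

theorem HallModule.coeff_symbol [DecidableEq (IsometryClass k D)] (c e : IsometryClass k D) :
    HallModule.coeff c (HallModule.symbol e) = if e = c then 1 else 0 := by
  refine Eq.trans ?_ (Finsupp.single_apply (a := e) (a' := c) (b := (1 : ℚ)))
  rfl

theorem HallModule.ext_coeff {m m' : HallModule k D}
    (h : ∀ N : SDRep k D, HallModule.coeff N.cls m = HallModule.coeff N.cls m') : m = m' :=
  Finsupp.ext fun c => by rw [← c.cls_out]; exact h c.out

theorem sum_mul_ite_support {α : Type*} (f : α →₀ ℚ) (a : α) [DecidableEq α] :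
    (∑ x ∈ f.support, f x * if a = x then 1 else 0) = f a := by
  simp only [mul_ite, mul_one, mul_zero, Finset.sum_ite_eq, Finsupp.mem_support_iff]
  split_ifs with h
  · rfl
  · exact (not_not.1 h).symm

/-- Exchanges a sum over pairs of classes, weighted by numbers of objects with these classes, for a
sum over the objects. With subrepresentations as objects, Hall numbers disappear from all later
computations. -/
theorem sum_mul_card_fiber {ι α β : Type*} [Fintype ι] (f : α →₀ ℚ) (g : β →₀ ℚ) (p : ι → Prop)
    [DecidablePred p] (a : ι → α) (b : ι → β) :
    (∑ x ∈ f.support, ∑ y ∈ g.support, f x * g y * (Nat.card {i // p i ∧ a i = x ∧ b i = y} : ℚ)) =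
      ∑ i, if p i then f (a i) * g (b i) else 0 := by
  classical
  have h (x : α) (y : β) : (Nat.card {i // p i ∧ a i = x ∧ b i = y} : ℚ) =
      ∑ i, if p i then (if a i = x then (1 : ℚ) else 0) * (if b i = y then 1 else 0) else 0 := by
    rw [Nat.card_eq_fintype_card, Fintype.card_subtype, Finset.card_filter]
    push_cast
    refine Finset.sum_congr rfl fun i _ => ?_
    by_cases h1 : p i <;> by_cases h2 : a i = x <;> by_cases h3 : b i = y <;> simp [h1, h2, h3]
  simp only [h, Finset.mul_sum]
  rw [Finset.sum_congr rfl fun x _ => Finset.sum_comm, Finset.sum_comm]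
  refine Finset.sum_congr rfl fun i _ => ?_
  split_ifs with hp
  · rw [← sum_mul_ite_support f (a i), ← sum_mul_ite_support g (b i), Finset.sum_mul_sum]
    exact Finset.sum_congr rfl fun x _ => Finset.sum_congr rfl fun y _ => by ring
  · simp

/-- Products are defined on chosen representatives; transport along an isomorphism permits
evaluating coefficients at any representation. -/
theorem hallNumber_cls_out (X : Rep k Q) (U V : IsoClass k Q) :
    hallNumber X.cls.out U V = hallNumber X U V := by
  obtain ⟨e⟩ := Rep.cls_eq_iff.1 X.cls.cls_out
  refine Nat.card_congr ((Rep.SubRep.transportEquiv e).subtypeEquiv fun W => ?_)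
  change _ ↔ (W.transport e).toRep.cls = U ∧ (W.transport e).quot.cls = V
  rw [Rep.SubRep.toRep_transport_cls, Rep.SubRep.quot_transport_cls]

theorem sdHallNumber_cls_out (N : SDRep k D) (U : IsoClass k Q) (M : IsometryClass k D) :
    sdHallNumber N.cls.out U M = sdHallNumber N U M := by
  obtain ⟨e⟩ := SDRep.cls_eq_iff.1 N.cls.cls_out
  refine Nat.card_congr ((Rep.SubRep.transportEquiv e.iso).subtypeEquiv fun W => ?_)
  change _ ↔ N.IsIsotropic (W.transport e.iso) ∧ (W.transport e.iso).toRep.cls = U ∧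
    (N.reduction (W.transport e.iso)).cls = M
  rw [Rep.SubRep.toRep_transport_cls, SDRep.isIsotropic_transport]
  rw [SDRep.reduction_transport_cls]

variable [Finite k] [Fintype Q]

instance Rep.SubRep.fintype (U : Rep k Q) : Fintype U.SubRep := Fintype.ofFinite _

open scoped Classical in
theorem Rep.SubRep.sum_subRep {U : Rep k Q} (W : U.SubRep) (F : W.toRep.SubRep → ℚ) :
    ∑ V, F V = ∑ V : U.SubRep, if V ≤ W then F (V.restrict W) else 0 := by
  rw [← Finset.sum_filter]
  refine Finset.sum_bij' (fun V _ => extend V) (fun V _ => V.restrict W) ?_ ?_ ?_ ?_ ?_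
  · exact fun V _ => Finset.mem_filter.2 ⟨Finset.mem_univ _, extend_le V⟩
  · exact fun _ _ => Finset.mem_univ _
  · exact fun V _ => restrict_extend V
  · exact fun V hV => extend_restrict (Finset.mem_filter.1 hV).2
  · exact fun V _ => by rw [restrict_extend]

open scoped Classical in
theorem SDRep.sum_reduction_subRep {N : SDRep k D} {V : N.rep.SubRep} (hV : N.IsIsotropic V)
    (F : (N.reduction V).rep.SubRep → ℚ) :
    (∑ W, if (N.reduction V).IsIsotropic W then F W else 0) =
      ∑ W : N.rep.SubRep, if V ≤ W ∧ N.IsIsotropic W then F (N.proj V W) else 0 := by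
  have le {W : N.rep.SubRep} (h : V ≤ W ∧ N.IsIsotropic W) : W ≤ N.perp V :=
    (N.isIsotropic_iff.1 h.2).trans (N.perp_anti h.1)
  rw [← Finset.sum_filter, ← Finset.sum_filter]
  refine Finset.sum_bij' (fun W _ => N.lift W) (fun W _ => N.proj V W) ?_ ?_ ?_ ?_ ?_
  · exact fun W hW => Finset.mem_filter.2 ⟨Finset.mem_univ _, le_lift hV W,
      (isIsotropic_lift hV).2 (Finset.mem_filter.1 hW).2⟩
  · intro W hW
    have h := (Finset.mem_filter.1 hW).2
    exact Finset.mem_filter.2 ⟨Finset.mem_univ _, (isIsotropic_proj h.1 (le h)).2 h.2⟩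
  · exact fun W _ => proj_lift hV W
  · intro W hW
    have h := (Finset.mem_filter.1 hW).2
    exact lift_proj h.1 (le h)
  · exact fun W _ => by rw [proj_lift hV]

variable [Finite (Quiver.Total Q)]

theorem HallAlgebra.coeff_mul (f g : HallAlgebra k Q) (X : Rep k Q) :
    HallAlgebra.coeff X.cls (f * g) =
      ∑ W : X.SubRep, HallAlgebra.coeff W.toRep.cls f * HallAlgebra.coeff W.quot.cls g := by
  have h1 := sum_mul_card_fiber f g (fun _ : X.SubRep => True) (fun W => W.toRep.cls)
    (fun W => W.quot.cls)
  simp only [true_and, if_true] at h1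
  refine Eq.trans ?_ h1
  change HallAlgebra.coeff X.cls (∑ U ∈ Finsupp.support (M := ℚ) f, ∑ V ∈ Finsupp.support (M := ℚ) g,
    (HallAlgebra.coeff U f * HallAlgebra.coeff V g) • HallAlgebra.symbolMul U V) = _
  simp only [map_sum, map_smul, smul_eq_mul]
  refine Finset.sum_congr rfl fun U _ => Finset.sum_congr rfl fun V _ => ?_
  congr 1
  exact congrArg Nat.cast (hallNumber_cls_out X U V)

open scoped Classical in
theorem HallModule.coeff_act (f : HallAlgebra k Q) (m : HallModule k D) (N : SDRep k D) :
    HallModule.coeff N.cls (HallModule.act f m) =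
      ∑ W : N.rep.SubRep, if N.IsIsotropic W then
        HallAlgebra.coeff W.toRep.cls f * HallModule.coeff (N.reduction W).cls m else 0 := by
  refine Eq.trans ?_ (sum_mul_card_fiber f m N.IsIsotropic (fun W => W.toRep.cls)
    (fun W => (N.reduction W).cls))
  change HallModule.coeff N.cls (∑ U ∈ Finsupp.support (M := ℚ) f, ∑ M ∈ Finsupp.support (M := ℚ) m,
    (HallAlgebra.coeff U f * HallModule.coeff M m) • HallModule.symbolAct U M) = _
  simp only [map_sum, map_smul, smul_eq_mul]
  refine Finset.sum_congr rfl fun U _ => Finset.sum_congr rfl fun V _ => ?_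
  congr 1
  exact congrArg Nat.cast (sdHallNumber_cls_out N U V)

theorem HallModule.act_one (m : HallModule k D) :
    HallModule.act (1 : HallAlgebra k Q) m = m := by
  classical
  refine HallModule.ext_coeff fun N => ?_
  rw [coeff_act, Finset.sum_eq_single (⊥ : N.rep.SubRep), if_pos N.isIsotropic_bot]
  · change HallAlgebra.coeff _ (HallAlgebra.symbol _) * _ = _
    rw [HallAlgebra.coeff_symbol, if_pos (Eq.symm (Rep.toRep_cls_eq_zero_iff.2 rfl)), one_mul,
      SDRep.reduction_bot_cls]
  · intro W _ hW
    change (if _ then HallAlgebra.coeff _ (HallAlgebra.symbol _) * _ else _) = _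
    rw [HallAlgebra.coeff_symbol, if_neg fun h => hW (Rep.toRep_cls_eq_zero_iff.1 (Eq.symm h)),
      zero_mul, ite_self]
  · exact fun h => (h (Finset.mem_univ _)).elim

/-- Both coefficients at N are the sum over pairs V ≤ W with W isotropic of f(V) g(W/V) m(N // W):
one side picks W first and then V inside it, the other V first and then W/V inside N // V. A product
over a list unfolds from its first entry, so together with `HallModule.act_one` this suffices,
without associativity of the Hall algebra. -/
theorem HallModule.act_mul (f g : HallAlgebra k Q) (m : HallModule k D) :
    HallModule.act (f * g) m = HallModule.act f (HallModule.act g m) := by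
  classical
  refine HallModule.ext_coeff fun N => ?_
  have h1 (V : N.rep.SubRep) (hV : N.IsIsotropic V) :
      HallModule.coeff (N.reduction V).cls (HallModule.act g m) =
        ∑ W : N.rep.SubRep, if V ≤ W ∧ N.IsIsotropic W then
          HallAlgebra.coeff (V.restrict W).quot.cls g * HallModule.coeff (N.reduction W).cls m
            else 0 := by
    rw [coeff_act, SDRep.sum_reduction_subRep hV fun W =>
      HallAlgebra.coeff W.toRep.cls g * HallModule.coeff ((N.reduction V).reduction W).cls m]
    refine Finset.sum_congr rfl fun W _ => ?_
    split_ifs with h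
    · rw [SDRep.proj_toRep_cls h.1 ((N.isIsotropic_iff.1 h.2).trans (N.perp_anti h.1)),
        SDRep.reduction_proj_cls h.1 h.2]
    · rfl
  rw [coeff_act, coeff_act]
  have h2 (W : N.rep.SubRep) :
      (if N.IsIsotropic W then HallAlgebra.coeff W.toRep.cls (f * g) *
        HallModule.coeff (N.reduction W).cls m else 0) =
      ∑ V : N.rep.SubRep, if V ≤ W ∧ N.IsIsotropic W then HallAlgebra.coeff V.toRep.cls f *
        (HallAlgebra.coeff (V.restrict W).quot.cls g * HallModule.coeff (N.reduction W).cls m)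
          else 0 := by
    split_ifs with hW
    · rw [HallAlgebra.coeff_mul, Rep.SubRep.sum_subRep, Finset.sum_mul]
      refine Finset.sum_congr rfl fun V _ => ?_
      by_cases h : V ≤ W
      · rw [if_pos h, if_pos ⟨h, hW⟩, Rep.SubRep.toRep_restrict_cls h, mul_assoc]
      · rw [if_neg h, if_neg fun h' => h h'.1, zero_mul]
    · simp [hW]
  rw [Finset.sum_congr rfl fun W _ => h2 W, Finset.sum_comm]
  refine Finset.sum_congr rfl fun V _ => ?_
  split_ifs with hV
  · rw [h1 V hV, Finset.mul_sum]
    exact Finset.sum_congr rfl fun W _ => by rw [mul_ite, mul_zero]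
  · exact Finset.sum_eq_zero fun W _ => if_neg fun h => hV (h.2.mono h.1)

end Hall

/-! ### Slopes, degrees and the destabilizing isotropic subrepresentation. -/

section Stability

variable {Q : Type v} [Fintype Q]

/-- The total dimension. -/
def size : (Q → ℕ) →+ ℕ where
  toFun d := ∑ i, d i
  map_zero' := by simp
  map_add' d e := by simp [Finset.sum_add_distrib]

/-- The value of the stability at a dimension vector. -/
def degree (θ : (Q → ℤ) →+ ℤ) : (Q → ℕ) →+ ℤ where
  toFun d := θ fun i => (d i : ℤ)
  map_zero' := θ.map_zero
  map_add' d e := by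
    rw [← map_add]
    congr 1

/-- `θ(d) - c dim d`. -/
def excess (θ : (Q → ℤ) →+ ℤ) (c : ℚ) (d : Q → ℕ) : ℚ := degree θ d - c * size d

theorem slope_eq (θ : (Q → ℤ) →+ ℤ) (d : Q → ℕ) : slope θ d = degree θ d / size d := rfl

theorem size_pos {d : Q → ℕ} (hd : d ≠ 0) : 0 < size d := by
  obtain ⟨i, hi⟩ := Function.ne_iff.1 hd
  exact (Nat.pos_of_ne_zero hi).trans_le
    (Finset.single_le_sum (fun j _ => Nat.zero_le (d j)) (Finset.mem_univ i))

theorem slope_zero (θ : (Q → ℤ) →+ ℤ) : slope θ (0 : Q → ℕ) = 0 := by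
  rw [slope_eq, map_zero, Int.cast_zero, zero_div]

/-- The case d = 0 is included thanks to the convention 0/0 = 0. -/
theorem slope_pos_iff (θ : (Q → ℤ) →+ ℤ) (d : Q → ℕ) : 0 < slope θ d ↔ 0 < degree θ d := by
  rcases eq_or_ne d 0 with rfl | hd
  · rw [slope_zero, map_zero]
    exact ⟨fun h => (lt_irrefl _ h).elim, fun h => (lt_irrefl _ h).elim⟩
  · rw [slope_eq, div_pos_iff_of_pos_right (Nat.cast_pos.2 (size_pos hd)), Int.cast_pos]

/-- Comparison of slopes with a fixed c becomes the sign of a function additive in d, so that seesaw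
arguments turn into linear arithmetic. -/
theorem slope_le_iff (θ : (Q → ℤ) →+ ℤ) {d : Q → ℕ} (hd : d ≠ 0) (c : ℚ) :
    slope θ d ≤ c ↔ excess θ c d ≤ 0 := by
  rw [slope_eq, div_le_iff₀ (Nat.cast_pos.2 (size_pos hd)), excess, sub_nonpos]

theorem slope_lt_iff (θ : (Q → ℤ) →+ ℤ) {d : Q → ℕ} (hd : d ≠ 0) (c : ℚ) :
    slope θ d < c ↔ excess θ c d < 0 := by
  rw [slope_eq, div_lt_iff₀ (Nat.cast_pos.2 (size_pos hd)), excess, sub_neg]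

theorem slope_eq_iff (θ : (Q → ℤ) →+ ℤ) {d : Q → ℕ} (hd : d ≠ 0) (c : ℚ) :
    slope θ d = c ↔ excess θ c d = 0 := by
  rw [slope_eq, div_eq_iff (Nat.cast_pos.2 (size_pos hd)).ne', excess, sub_eq_zero]

theorem excess_add (θ : (Q → ℤ) →+ ℤ) (c : ℚ) (d e : Q → ℕ) :
    excess θ c (d + e) = excess θ c d + excess θ c e := by
  simp only [excess, map_add]
  push_cast
  ring

theorem excess_zero (θ : (Q → ℤ) →+ ℤ) (c : ℚ) : excess θ c (0 : Q → ℕ) = 0 := by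
  simp [excess]

theorem excess_slope_self (θ : (Q → ℤ) →+ ℤ) (d : Q → ℕ) : excess θ (slope θ d) d = 0 := by
  rcases eq_or_ne d 0 with rfl | hd
  · exact excess_zero θ _
  · exact (slope_eq_iff θ hd _).1 rfl

omit [Fintype Q] in
theorem degree_eq_zero_of_isInvariant [Quiver.{w} Q] {σ : QuiverInvolution Q}
    {θ : (Q → ℤ) →+ ℤ} (hθ : IsCompatible σ θ) {d : Q → ℕ} (hd : IsInvariant σ d) :
    degree θ d = 0 := by
  have h1 := hθ fun i => (d i : ℤ)
  have h2 : (fun i => (d (σ.node i) : ℤ)) = fun i => (d i : ℤ) := funext fun i => by rw [hd]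
  rw [h2] at h1
  change θ _ = 0
  linarith

variable {k : Type u} [Field k] [Quiver.{w} Q]

namespace Rep

omit [Fintype Q] in
theorem SubRep.dim_ne_zero {U : Rep k Q} {W : U.SubRep} : W.dim ≠ 0 ↔ W ≠ ⊥ :=
  SubRep.dim_eq_zero.not

theorem SubRep.size_mono {U : Rep k Q} {V W : U.SubRep} (h : V ≤ W) : size V.dim ≤ size W.dim :=
  Finset.sum_le_sum fun i _ => SubRep.dim_mono h i

theorem SubRep.eq_of_le_of_size_le {U : Rep k Q} {V W : U.SubRep} (h : V ≤ W)
    (h' : size W.dim ≤ size V.dim) : V = W := by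
  refine SubRep.eq_of_le_of_dim_le h fun i => ?_
  have h1 := (Finset.sum_eq_sum_iff_of_le (s := Finset.univ) fun i _ => SubRep.dim_mono h i).1
    (le_antisymm (SubRep.size_mono h) h')
  exact (h1 i (Finset.mem_univ i)).ge

theorem isSemistable_iff {U : Rep k Q} {θ : (Q → ℤ) →+ ℤ} :
    U.IsSemistable θ ↔ ∀ W : U.SubRep, W ≠ ⊥ → W ≠ ⊤ → slope θ W.dim ≤ slope θ U.dimVec := by
  refine forall_congr' fun W => ?_
  rw [SubRep.ne_bot_iff, SubRep.ne_top_iff]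
  rfl

theorem isSemistable_of_iso {U V : Rep k Q} {θ : (Q → ℤ) →+ ℤ} (e : U.Iso V)
    (h : V.IsSemistable θ) : U.IsSemistable θ := by
  rw [isSemistable_iff] at h ⊢
  intro W hW hW'
  have h1 : (W.transport e).dim = W.dim := by
    rw [SubRep.dim, ← Rep.dimVec_cls, SubRep.toRep_transport_cls, Rep.dimVec_cls, SubRep.dim]
  rw [← h1, e.dimVec_eq]
  refine h _ ?_ fun h2 => hW' ?_
  · rwa [← SubRep.dim_ne_zero, h1, SubRep.dim_ne_zero]
  · refine SubRep.eq_of_le_of_dim_le le_top ?_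
    rw [← h1, h2, SubRep.dim_top, SubRep.dim_top, e.dimVec_eq]

theorem isSemistable_cls_out {U : Rep k Q} {θ : (Q → ℤ) →+ ℤ} :
    U.cls.out.IsSemistable θ ↔ U.IsSemistable θ := by
  obtain ⟨e⟩ := Rep.cls_eq_iff.1 U.cls.cls_out
  exact ⟨isSemistable_of_iso e.symm, isSemistable_of_iso e⟩

/-- The subrepresentations 0 and U have excess 0 and may be admitted, which removes the side
conditions from the definition. -/
theorem toRep_isSemistable_iff {X : Rep k Q} {U : X.SubRep} {θ : (Q → ℤ) →+ ℤ} :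
    U.toRep.IsSemistable θ ↔ ∀ V ≤ U, excess θ (slope θ U.dim) V.dim ≤ 0 := by
  rw [isSemistable_iff]
  constructor
  · intro h V hV
    by_cases h0 : V = ⊥
    · rw [h0, SubRep.dim_bot, excess_zero]
    by_cases h1 : V = U
    · rw [h1, excess_slope_self]
    rw [← slope_le_iff θ (SubRep.dim_ne_zero.2 h0)]
    have h2 := h (V.restrict U) ?_ ?_
    · rwa [SubRep.dim_restrict hV] at h2
    · rwa [← SubRep.dim_ne_zero, SubRep.dim_restrict hV, SubRep.dim_ne_zero]
    · intro h2
      refine h1 (SubRep.eq_of_le_of_dim_le hV ?_)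
      rw [← SubRep.dim_restrict hV, h2, SubRep.dim_top]
      exact le_rfl
  · intro h W hW _
    have h1 := h _ (SubRep.extend_le W)
    rw [SubRep.dim_extend] at h1
    exact (slope_le_iff θ (SubRep.dim_ne_zero.2 hW) _).2 h1

end Rep

namespace SDRep

open SelfDualQuiver.Rep

variable {σ : QuiverInvolution Q} {D : DualityStructure σ} {N : SDRep k D} {θ : (Q → ℤ) →+ ℤ}

theorem size_reduction_lt {U : N.rep.SubRep} (hU : N.IsIsotropic U) (h : U ≠ ⊥) :
    size (N.reduction U).dimVec < size N.dimVec := by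
  have h1 : hyp σ U.dim = U.dim + fun i => U.dim (σ.node i) := rfl
  have h2 := size_pos (SubRep.dim_ne_zero.2 h)
  rw [← N.dimVec_reduction hU, map_add, h1, map_add]
  omega

-- The dimension vector of W^⊥ is dim N − σ(dim W); here θ(dim N) = 0 by invariance, and θ∘σ = −θ.
omit [Fintype Q] in
theorem degree_perp (hθ : IsCompatible σ θ) (W : N.rep.SubRep) :
    degree θ (N.perp W).dim = degree θ W.dim := by
  have h1 := congrArg (degree θ) (show _ + (fun i => W.dim (σ.node i)) = _ from
    funext (N.dim_perp_add W))
  have h2 : degree θ (fun i => W.dim (σ.node i)) = -degree θ W.dim := hθ fun i => (W.dim i : ℤ)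
  rw [map_add, degree_eq_zero_of_isInvariant hθ N.dimVec_isInvariant, h2] at h1
  linarith

omit [Fintype Q] in
theorem degree_sup_add_degree_inf {U : Rep k Q} (θ : (Q → ℤ) →+ ℤ) (V W : U.SubRep) :
    degree θ (V ⊔ W).dim + degree θ (V ⊓ W).dim = degree θ V.dim + degree θ W.dim := by
  rw [← map_add, SubRep.dim_sup_add_dim_inf, map_add]

theorem excess_sup_add_excess_inf {U : Rep k Q} (θ : (Q → ℤ) →+ ℤ) (c : ℚ) (V W : U.SubRep) :
    excess θ c (V ⊔ W).dim + excess θ c (V ⊓ W).dim = excess θ c V.dim + excess θ c W.dim := by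
  rw [← excess_add, SubRep.dim_sup_add_dim_inf, excess_add]

-- The modular law for V and U^⊥, where V + U^⊥ is replaced by its orthogonal V^⊥ ∩ U, of the same
-- degree.
omit [Fintype Q] in
theorem degree_inf_perp (hθ : IsCompatible σ θ) (V U : N.rep.SubRep) :
    degree θ (V ⊓ N.perp U).dim + degree θ (U ⊓ N.perp V).dim =
      degree θ V.dim + degree θ U.dim := by
  have h1 := degree_sup_add_degree_inf θ V (N.perp U)
  rw [← degree_perp hθ (V ⊔ N.perp U), perp_sup, perp_perp, degree_perp hθ U,
    inf_comm (N.perp V)] at h1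
  rw [← h1, add_comm]

theorem isSemistable_iff (hθ : IsCompatible σ θ) :
    N.IsSemistable θ ↔ ∀ W, N.IsIsotropic W → degree θ W.dim ≤ 0 := by
  have h0 : slope θ N.dimVec = 0 := by
    rw [slope_eq, degree_eq_zero_of_isInvariant hθ N.dimVec_isInvariant, Int.cast_zero, zero_div]
  refine forall_congr' fun W => ?_
  rw [← SubRep.ne_bot_iff, h0, ← not_lt, ← not_lt]
  change _ → _ → ¬ 0 < slope θ W.dim ↔ _
  rw [slope_pos_iff]
  refine ⟨fun h hW => ?_, fun h _ => h⟩
  by_cases hb : W = ⊥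
  · rw [hb, SubRep.dim_bot, map_zero]
    exact lt_irrefl _
  · exact h hb hW

theorem isSemistable_of_isometry {M : SDRep k D} (hθ : IsCompatible σ θ) (e : N.Isometry M)
    (h : M.IsSemistable θ) : N.IsSemistable θ := by
  rw [isSemistable_iff hθ] at h ⊢
  intro W hW
  have h1 : (W.transport e.iso).dim = W.dim := by
    rw [SubRep.dim, ← Rep.dimVec_cls, SubRep.toRep_transport_cls, Rep.dimVec_cls, SubRep.dim]
  rw [← h1]
  exact h _ ((isIsotropic_transport e).2 hW)

theorem isSemistable_cls_out (hθ : IsCompatible σ θ) :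
    N.cls.out.IsSemistable θ ↔ N.IsSemistable θ := by
  obtain ⟨e⟩ := SDRep.cls_eq_iff.1 N.cls.cls_out
  obtain ⟨e'⟩ := SDRep.cls_eq_iff.1 N.cls.cls_out.symm
  exact ⟨isSemistable_of_isometry hθ e', isSemistable_of_isometry hθ e⟩

/-- All non-zero isotropic subrepresentations have slope less than `b`. -/
def SlopesLT (N : SDRep k D) (θ : (Q → ℤ) →+ ℤ) (b : WithTop ℚ) : Prop :=
  ∀ W : N.rep.SubRep, W ≠ ⊥ → N.IsIsotropic W → (slope θ W.dim : WithTop ℚ) < b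

/-- The first step of the self-dual Harder–Narasimhan filtration of a self-dual representation
which is not semistable. -/
structure IsDestabilizing (N : SDRep k D) (θ : (Q → ℤ) →+ ℤ) (U : N.rep.SubRep) : Prop where
  isotropic : N.IsIsotropic U
  ne_bot : U ≠ ⊥
  semistable : U.toRep.IsSemistable θ
  slope_pos : 0 < slope θ U.dim
  slopesLT : (N.reduction U).SlopesLT θ (slope θ U.dim)

/-- Isotropic subrepresentations of N // U are the W/U, and W/U has the same excess as W since U has
excess 0 for its own slope. -/
theorem slopesLT_reduction_iff {U : N.rep.SubRep} (hU : N.IsIsotropic U) :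
    (N.reduction U).SlopesLT θ (slope θ U.dim) ↔
      ∀ W, U ≤ W → W ≠ U → N.IsIsotropic W → excess θ (slope θ U.dim) W.dim < 0 := by
  have key {W : N.rep.SubRep} (h : U ≤ W) (h' : W ≤ N.perp U) :
      excess θ (slope θ U.dim) (N.proj U W).dim = excess θ (slope θ U.dim) W.dim := by
    rw [← dim_proj h h', excess_add, excess_slope_self, zero_add]
  constructor
  · intro h W hUW hne hW
    have hp : W ≤ N.perp U := (N.isIsotropic_iff.1 hW).trans (N.perp_anti hUW)
    have hb : N.proj U W ≠ ⊥ := fun h0 => hne ((proj_eq_bot_iff hUW hp).1 h0)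
    have h1 := WithTop.coe_lt_coe.1 (h _ hb ((isIsotropic_proj hUW hp).2 hW))
    rwa [slope_lt_iff θ (SubRep.dim_ne_zero.2 hb), key hUW hp] at h1
  · intro h W hb hW
    have h1 := key (le_lift hU W) (lift_le_perp W)
    rw [proj_lift hU] at h1
    rw [WithTop.coe_lt_coe, slope_lt_iff θ (SubRep.dim_ne_zero.2 hb), h1]
    refine h _ (le_lift hU W) (fun h0 => hb ?_) ((isIsotropic_lift hU).2 hW)
    rw [← proj_lift hU W, proj_eq_bot_iff (le_lift hU W) (lift_le_perp W), h0]

/-- V + U may fail to be isotropic, but (V ∩ U^⊥) + U is isotropic. The excess of V is at most that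
of V ∩ U^⊥, which the modular law with U bounds by semistability of U and the slope condition on N
// U. -/
theorem IsDestabilizing.excess_nonpos (hθ : IsCompatible σ θ) {U : N.rep.SubRep}
    (h : N.IsDestabilizing θ U) {V : N.rep.SubRep} (hV : N.IsIsotropic V) :
    excess θ (slope θ U.dim) V.dim ≤ 0 ∧ (excess θ (slope θ U.dim) V.dim = 0 → V ≤ U) := by
  set c := slope θ U.dim with hc
  have hU0 : excess θ c U.dim = 0 := excess_slope_self θ _
  have hss := Rep.toRep_isSemistable_iff.1 h.semistable
  have hlt := (slopesLT_reduction_iff h.isotropic).1 h.slopesLT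
  rw [← hc] at hss hlt
  have hcpos : 0 < c := h.slope_pos
  have h1 := degree_inf_perp hθ V U
  have h2 := hss _ (inf_le_left : U ⊓ N.perp V ≤ U)
  have h3 := SubRep.size_mono (inf_le_left : U ⊓ N.perp V ≤ U)
  have h4 := SubRep.size_mono (inf_le_left : V ⊓ N.perp U ≤ V)
  -- Replacing the pair V, U by V ∩ U^⊥, U ∩ V^⊥ keeps the total degree and does not increase the
  -- sizes; since c > 0, the total excess does not decrease.
  have h3' := mul_le_mul_of_nonneg_left (Nat.cast_le (α := ℚ).2 h3) hcpos.le
  have h4' := mul_le_mul_of_nonneg_left (Nat.cast_le (α := ℚ).2 h4) hcpos.le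
  have h1' : (degree θ (V ⊓ N.perp U).dim + degree θ (U ⊓ N.perp V).dim : ℚ) =
      degree θ V.dim + degree θ U.dim := mod_cast h1
  have h5 := excess_sup_add_excess_inf θ c (V ⊓ N.perp U) U
  have h6 := hss _ (inf_le_right : (V ⊓ N.perp U) ⊓ U ≤ U)
  have hiso : N.IsIsotropic ((V ⊓ N.perp U) ⊔ U) :=
    (hV.mono inf_le_left).sup h.isotropic inf_le_right
  by_cases h7 : (V ⊓ N.perp U) ⊔ U = U
  · have h8 : V ⊓ N.perp U ≤ U := sup_eq_right.1 h7
    have h9 := hss _ h8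
    simp only [excess] at *
    -- Excess 0 leaves no room for a loss of size, so V = V ∩ U^⊥, which is contained in U in this
    -- case.
    refine ⟨by linarith, fun h10 => ?_⟩
    have h11 : c * size V.dim ≤ c * size (V ⊓ N.perp U).dim := by linarith
    have h12 : size V.dim ≤ size (V ⊓ N.perp U).dim :=
      Nat.cast_le.1 (le_of_mul_le_mul_left h11 hcpos)
    rw [SubRep.eq_of_le_of_size_le inf_le_left h12] at h8
    exact h8
  · have h8 := hlt _ le_sup_right h7 hiso
    simp only [excess] at *
    exact ⟨by linarith, fun h10 => by linarith⟩

theorem IsDestabilizing.slope_le (hθ : IsCompatible σ θ) {U : N.rep.SubRep}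
    (h : N.IsDestabilizing θ U) {V : N.rep.SubRep} (hV : N.IsIsotropic V) (hb : V ≠ ⊥) :
    slope θ V.dim ≤ slope θ U.dim :=
  (slope_le_iff θ (SubRep.dim_ne_zero.2 hb) _).2 (h.excess_nonpos hθ hV).1

/-- Both have the largest slope among non-zero isotropic subrepresentations, so each falls in the
equality case of `excess_nonpos` for the other. -/
theorem IsDestabilizing.unique (hθ : IsCompatible σ θ) {U V : N.rep.SubRep}
    (hU : N.IsDestabilizing θ U) (hV : N.IsDestabilizing θ V) : U = V := by
  have key {U V : N.rep.SubRep} (hU : N.IsDestabilizing θ U) (hV : N.IsDestabilizing θ V) :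
      V ≤ U := by
    refine (hU.excess_nonpos hθ hV.isotropic).2 ?_
    rw [← slope_eq_iff θ (SubRep.dim_ne_zero.2 hV.ne_bot)]
    exact le_antisymm (hU.slope_le hθ hV.isotropic hV.ne_bot)
      (hV.slope_le hθ hU.isotropic hU.ne_bot)
  exact le_antisymm (key hV hU) (key hU hV)

theorem exists_isDestabilizing [Finite k] (hθ : IsCompatible σ θ) (h : ¬ N.IsSemistable θ) :
    ∃ U, N.IsDestabilizing θ U := by
  rw [isSemistable_iff hθ] at h
  push Not at h
  obtain ⟨W, -, hW⟩ := h
  have hWb : W ≠ ⊥ := by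
    rintro rfl
    rw [SubRep.dim_bot, map_zero] at hW
    exact lt_irrefl _ hW
  have : Nonempty {V : N.rep.SubRep // V ≠ ⊥} := ⟨⟨W, hWb⟩⟩
  -- The maximal slope is taken over all non-zero subrepresentations, isotropic or not; isotropy of
  -- the maximizer is a consequence.
  obtain ⟨⟨X, hXb⟩, hX⟩ := Finite.exists_max fun V : {V : N.rep.SubRep // V ≠ ⊥} =>
    slope θ V.1.dim
  obtain ⟨c, hc⟩ : ∃ c, slope θ X.dim = c := ⟨_, rfl⟩
  have hcpos : 0 < c := hc ▸ ((slope_pos_iff θ _).2 hW).trans_le (hX ⟨W, hWb⟩)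
  have hle (V : N.rep.SubRep) : excess θ c V.dim ≤ 0 := by
    by_cases hb : V = ⊥
    · rw [hb, SubRep.dim_bot, excess_zero]
    · exact (slope_le_iff θ (SubRep.dim_ne_zero.2 hb) c).1 (hc ▸ hX ⟨V, hb⟩)
  have hX0 : excess θ c X.dim = 0 := (slope_eq_iff θ (SubRep.dim_ne_zero.2 hXb) c).1 hc
  have : Nonempty {V : N.rep.SubRep // excess θ c V.dim = 0} := ⟨⟨X, hX0⟩⟩
  obtain ⟨⟨U, hU0⟩, hU⟩ := Finite.exists_max fun V : {V : N.rep.SubRep // excess θ c V.dim = 0} =>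
    size V.1.dim
  -- No excess is positive, so by the modular law subrepresentations of excess 0 are closed under
  -- sums; one of maximal size contains all others.
  have hmax (V : N.rep.SubRep) (hV : excess θ c V.dim = 0) : V ≤ U := by
    have h1 := excess_sup_add_excess_inf θ c V U
    have h2 : excess θ c (V ⊔ U).dim = 0 := by
      have := hle (V ⊔ U)
      have := hle (V ⊓ U)
      linarith
    exact sup_eq_right.1 (SubRep.eq_of_le_of_size_le le_sup_right (hU ⟨_, h2⟩)).symm
  have hUb : U ≠ ⊥ := fun h => hXb (le_bot_iff.1 (h ▸ hmax X hX0))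
  have hUc : slope θ U.dim = c := (slope_eq_iff θ (SubRep.dim_ne_zero.2 hUb) c).2 hU0
  -- U ∩ U^⊥ has the degree of U and non-positive excess; with c > 0 it cannot be smaller than U.
  have hUiso : N.IsIsotropic U := by
    have h1 : degree θ (U ⊓ N.perp U).dim = degree θ U.dim := by
      linarith [degree_inf_perp hθ U U]
    have h2 := hle (U ⊓ N.perp U)
    rw [excess, h1] at h2
    rw [excess] at hU0
    have h3 : size U.dim ≤ size (U ⊓ N.perp U).dim :=
      Nat.cast_le.1 (le_of_mul_le_mul_left (a := c) (by linarith) hcpos)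
    exact N.isIsotropic_iff.2 (inf_eq_left.1 (SubRep.eq_of_le_of_size_le inf_le_left h3))
  refine ⟨U, hUiso, hUb, Rep.toRep_isSemistable_iff.2 fun V _ => hUc ▸ hle V, hUc ▸ hcpos,
    (slopesLT_reduction_iff hUiso).2 fun V hUV hne _ => ?_⟩
  rw [hUc]
  exact lt_of_le_of_ne (hle V) fun h => hne (le_antisymm (hmax V h) hUV)

end SDRep

end Stability

/-! ### Möbius-type sums over a conically contractible poset. -/

section Order

open scoped Classical in
/-- If `∑_{W ≥ V} T(W) = 1` for all `V` in a conically contractible poset `P`, with contraction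
`V ≥ r(V) ≤ q(r(V)) ≥ M`, then `∑_W T(W) = 1`. -/
theorem sum_eq_one_of_conical {A : Type*} [PartialOrder A] [Finite A] {P : Finset A} {T : A → ℚ}
    (hT : ∀ V ∈ P, ∑ W ∈ P with V ≤ W, T W = 1) {r q : A → A} {M : A} (hM : M ∈ P) (hrM : r M = M)
    (hr : ∀ V ∈ P, r V ∈ P) (hr_le : ∀ V, r V ≤ V) (hrr : ∀ V, r (r V) = r V) (hr_mono : Monotone r)
    (hq : ∀ V ∈ P, r V = V → q V ∈ P ∧ r (q V) = q V)
    (hq_le : ∀ V W, q V ≤ W ↔ V ≤ W ∧ M ≤ W) : ∑ W ∈ P, T W = 1 := by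
  obtain ⟨P', hP'⟩ : ∃ P', P' = P.filter fun V => r V = V := ⟨_, rfl⟩
  -- The pushforward of T along r, considered on the set P' of fixed points of r in P.
  set T' : A → ℚ := fun K => ∑ V ∈ P with r V = K, T V with hT'
  have fib (p : A → Prop) : ∑ K ∈ P' with p K, T' K = ∑ V ∈ P with p (r V), T V := by
    rw [← Finset.sum_fiberwise_of_maps_to (s := P.filter fun V => p (r V)) (t := P'.filter p)
      (g := r)]
    · refine Finset.sum_congr rfl fun K hK => ?_
      rw [hT', Finset.filter_filter]
      refine Finset.sum_congr (Finset.filter_congr fun V _ => ?_) fun _ _ => rfl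
      exact ⟨fun h => ⟨h ▸ (Finset.mem_filter.1 hK).2, h⟩, fun h => h.2⟩
    · intro V hV
      rw [Finset.mem_filter] at hV
      exact Finset.mem_filter.2 ⟨hP' ▸ Finset.mem_filter.2 ⟨hr V hV.1, hrr V⟩, hV.2⟩
  -- For K fixed by r, K ≤ r(V) is equivalent to K ≤ V, so the hypothesis on T passes to T'.
  have h1 (K : A) (hK : K ∈ P') : ∑ K' ∈ P' with K ≤ K', T' K' = 1 := by
    rw [hP', Finset.mem_filter] at hK
    rw [fib, ← hT K hK.1]
    refine Finset.sum_congr (Finset.filter_congr fun V _ => ?_) fun _ _ => rfl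
    exact ⟨fun h => h.trans (hr_le V), fun h => hK.2.symm.le.trans (hr_mono h)⟩
  -- Descending induction: the sums over K' ≥ K and over K' ≥ q(K), that is K' ≥ K with K' ≥ M, are
  -- both 1. Hence the K' ≥ K not above M contribute 0 in total, and all of them but K vanish by
  -- induction.
  have h2 (K : A) (hK : K ∈ P') (hMK : ¬ M ≤ K) : T' K = 0 := by
    induction K using WellFoundedGT.induction with
    | ind K ih =>
      have hK' := Finset.mem_filter.1 (hP' ▸ hK)
      have h3 := h1 K hK
      have h4 := h1 (q K) (hP' ▸ Finset.mem_filter.2 (hq K hK'.1 hK'.2))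
      rw [← Finset.sum_filter_add_sum_filter_not _ (fun K' => M ≤ K'), Finset.filter_filter,
        Finset.filter_filter] at h3
      simp only [hq_le] at h4
      rw [h4, add_eq_left] at h3
      rw [← h3]
      refine (Finset.sum_eq_single_of_mem K (Finset.mem_filter.2 ⟨hK, le_rfl, hMK⟩) ?_).symm
      intro K' hK1 hne
      obtain ⟨hK2, hle, hMK'⟩ := Finset.mem_filter.1 hK1
      exact ih K' (lt_of_le_of_ne hle hne.symm) hK2 hMK'
  have h3 := fib fun _ => True
  rw [Finset.filter_true, Finset.filter_true] at h3
  rw [← h3, ← h1 M (hP' ▸ Finset.mem_filter.2 ⟨hM, hrM⟩)]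
  refine (Finset.sum_filter_of_ne fun K hK hne => ?_).symm
  by_contra h
  exact hne (h2 K hK h)

end Order

/-! ### Splitting off the first entry of a sum over (d^•; d^∞). -/

section Recursion

variable {Q : Type v} [Fintype Q] [Quiver.{w} Q] {σ : QuiverInvolution Q}

-- An index is either (∅; d), admissible because d is invariant, or a first entry x followed by an
-- index of σ-weight d − H(x). The condition H(x) ≤ d makes the truncated subtraction a true one,
-- and x ≤ H(x) ≤ d confines x to a finite box.
open scoped Classical in
theorem sum_weightSet {d : Q → ℕ} (hd : IsInvariant σ d) (φ : List (Q → ℕ) × (Q → ℕ) → ℚ) :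
    ∑ p ∈ (finite_weightSet σ d).toFinset, φ p =
      φ ([], d) + ∑ x ∈ (Set.finite_Iic d).toFinset, if x ≠ 0 ∧ hyp σ x ≤ d then
        ∑ p ∈ (finite_weightSet σ (d - hyp σ x)).toFinset, φ (x :: p.1, p.2) else 0 := by
  have h0 : ([], d) ∈ (finite_weightSet σ d).toFinset := by
    simp [weightSet, hd]
  rw [← Finset.add_sum_erase _ _ h0, ← Finset.sum_filter, Finset.sum_sigma']
  congr 1
  symm
  refine Finset.sum_bij (fun z _ => (z.1 :: z.2.1, z.2.2)) ?_ ?_ ?_ fun _ _ => rfl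
  · rintro ⟨x, l, e⟩ h
    simp only [Finset.mem_sigma, Finset.mem_filter, Set.Finite.mem_toFinset, weightSet,
      Set.mem_ofPred_eq] at h
    obtain ⟨⟨-, hx0, hxd⟩, hl, he, hs⟩ := h
    simp only [Finset.mem_erase, Set.Finite.mem_toFinset, weightSet, Set.mem_ofPred_eq,
      List.forall_mem_cons, List.map_cons, List.sum_cons]
    refine ⟨by simp, ⟨hx0, hl⟩, he, ?_⟩
    rw [add_assoc, hs, add_tsub_cancel_of_le hxd]
  · rintro ⟨x, l, e⟩ - ⟨x', l', e'⟩ - h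
    simp only [Prod.mk.injEq, List.cons.injEq] at h
    obtain ⟨⟨rfl, rfl⟩, rfl⟩ := h
    rfl
  · rintro ⟨l, e⟩ h
    simp only [Finset.mem_erase, Set.Finite.mem_toFinset, weightSet, Set.mem_ofPred_eq] at h
    obtain ⟨hne, hl, he, hs⟩ := h
    cases l with
    | nil =>
      simp only [List.map_nil, List.sum_nil, zero_add] at hs
      exact (hne (by rw [hs])).elim
    | cons x l =>
      rw [List.map_cons, List.sum_cons, add_assoc] at hs
      rw [List.forall_mem_cons] at hl
      have hxd : hyp σ x ≤ d := hs ▸ le_self_add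
      have hx : x ≤ hyp σ x := fun i => Nat.le_add_right _ _
      refine ⟨⟨x, l, e⟩, ?_, rfl⟩
      simp only [Finset.mem_sigma, Finset.mem_filter, Set.Finite.mem_toFinset, weightSet,
        Set.mem_ofPred_eq]
      refine ⟨⟨hx.trans hxd, hl.1, hxd⟩, hl.2, he, ?_⟩
      rw [← hs, add_tsub_cancel_left]

variable {k : Type u} [Field k] [Finite k] [Finite (Quiver.Total Q)] {D : DualityStructure σ}

/-- The sum of the `C(d^•) a(d^1) ⋯ a(d^n) ⋆ m(d^∞)` over all `(d^•; d^∞)` of `σ`-weight `d`. -/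
def weightedSum (a : (Q → ℕ) → HallAlgebra k Q) (m : (Q → ℕ) → HallModule k D) (d : Q → ℕ)
    (C : List (Q → ℕ) → ℚ) : HallModule k D :=
  ∑ p ∈ (finite_weightSet σ d).toFinset, C p.1 • HallModule.act (p.1.map a).prod (m p.2)

/-- The action respects the grading by dimension, since dim N = H(dim U) + dim(N // U) for isotropic
U. -/
theorem coeff_act_prod_eq_zero {a : (Q → ℕ) → HallAlgebra k Q} {m : (Q → ℕ) → HallModule k D}
    (ha : ∀ x (U : Rep k Q), U.dimVec ≠ x → HallAlgebra.coeff U.cls (a x) = 0)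
    (hm : ∀ x (N : SDRep k D), N.dimVec ≠ x → HallModule.coeff N.cls (m x) = 0)
    (l : List (Q → ℕ)) (e : Q → ℕ) (N : SDRep k D) (hN : (l.map (hyp σ)).sum + e ≠ N.dimVec) :
    HallModule.coeff N.cls (HallModule.act (l.map a).prod (m e)) = 0 := by
  classical
  induction l generalizing N with
  | nil =>
    rw [List.map_nil, List.prod_nil, HallModule.act_one]
    refine hm e N fun h => hN ?_
    rw [List.map_nil, List.sum_nil, zero_add, h]
  | cons x l ih =>
    rw [List.map_cons, List.prod_cons, HallModule.act_mul, HallModule.coeff_act]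
    refine Finset.sum_eq_zero fun U _ => ?_
    split_ifs with hU
    · by_cases hx : U.dim = x
      · rw [ih, mul_zero]
        intro h
        apply hN
        rw [List.map_cons, List.sum_cons, add_assoc, h, ← hx, N.dimVec_reduction hU]
      · rw [ha x U.toRep hx, zero_mul]
    · rfl

theorem coeff_weightedSum_eq_zero {a : (Q → ℕ) → HallAlgebra k Q}
    {m : (Q → ℕ) → HallModule k D}
    (ha : ∀ x (U : Rep k Q), U.dimVec ≠ x → HallAlgebra.coeff U.cls (a x) = 0)
    (hm : ∀ x (N : SDRep k D), N.dimVec ≠ x → HallModule.coeff N.cls (m x) = 0)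
    (C : List (Q → ℕ) → ℚ) {d : Q → ℕ} {N : SDRep k D} (hN : N.dimVec ≠ d) :
    HallModule.coeff N.cls (weightedSum a m d C) = 0 := by
  rw [weightedSum, map_sum]
  refine Finset.sum_eq_zero fun p hp => ?_
  have h : (p.1.map (hyp σ)).sum + p.2 = d := ((Set.Finite.mem_toFinset _).1 hp).2.2
  rw [map_smul, coeff_act_prod_eq_zero ha hm _ _ _ (h ▸ hN.symm), smul_zero]

-- The common engine of both formulas. The first entry x must be dim U for the first step U of the
-- chain, and the remaining σ-weight dim N − H(x) is then the dimension vector of N // U, so the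
-- remaining sum has the same shape.
open scoped Classical in
theorem coeff_weightedSum {a : (Q → ℕ) → HallAlgebra k Q}
    (ha : ∀ x (U : Rep k Q), U.dimVec ≠ x → HallAlgebra.coeff U.cls (a x) = 0)
    (m : (Q → ℕ) → HallModule k D) (C : List (Q → ℕ) → ℚ) (N : SDRep k D) :
    HallModule.coeff N.cls (weightedSum a m N.dimVec C) =
      C [] * HallModule.coeff N.cls (m N.dimVec) +
        ∑ U : N.rep.SubRep, if N.IsIsotropic U ∧ U ≠ ⊥ then
          HallAlgebra.coeff U.toRep.cls (a U.dim) * HallModule.coeff (N.reduction U).cls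
            (weightedSum a m (N.reduction U).dimVec fun l => C (U.dim :: l)) else 0 := by
  have h1 (x : Q → ℕ) : (if x ≠ 0 ∧ hyp σ x ≤ N.dimVec then
      ∑ p ∈ (finite_weightSet σ (N.dimVec - hyp σ x)).toFinset, C (x :: p.1) *
        HallModule.coeff N.cls (HallModule.act ((x :: p.1).map a).prod (m p.2)) else 0) =
      ∑ U : N.rep.SubRep, if (x ≠ 0 ∧ hyp σ x ≤ N.dimVec) ∧ N.IsIsotropic U then
        HallAlgebra.coeff U.toRep.cls (a x) * HallModule.coeff (N.reduction U).cls
          (weightedSum a m (N.dimVec - hyp σ x) fun l => C (x :: l)) else 0 := by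
    split_ifs with hx
    · simp only [hx, ne_eq, not_false_eq_true, and_self, true_and]
      have h2 (p : List (Q → ℕ) × (Q → ℕ)) : C (x :: p.1) *
          HallModule.coeff N.cls (HallModule.act ((x :: p.1).map a).prod (m p.2)) =
          ∑ U : N.rep.SubRep, if N.IsIsotropic U then HallAlgebra.coeff U.toRep.cls (a x) *
            (C (x :: p.1) * HallModule.coeff (N.reduction U).cls
              (HallModule.act (p.1.map a).prod (m p.2))) else 0 := by
        rw [List.map_cons, List.prod_cons, HallModule.act_mul, HallModule.coeff_act,
          Finset.mul_sum]
        exact Finset.sum_congr rfl fun U _ => by rw [mul_ite, mul_zero, mul_left_comm]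
      rw [Finset.sum_congr rfl fun p _ => h2 p, Finset.sum_comm]
      refine Finset.sum_congr rfl fun U _ => ?_
      split_ifs
      · rw [weightedSum, map_sum, Finset.mul_sum]
        exact Finset.sum_congr rfl fun p _ => by rw [map_smul, smul_eq_mul]
      · exact Finset.sum_const_zero
    · simp [hx]
  rw [weightedSum, map_sum]
  simp only [map_smul, smul_eq_mul]
  rw [sum_weightSet N.dimVec_isInvariant, List.map_nil, List.prod_nil, HallModule.act_one]
  congr 1
  rw [Finset.sum_congr rfl fun x _ => h1 x, Finset.sum_comm]
  refine Finset.sum_congr rfl fun U _ => ?_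
  by_cases hU : N.IsIsotropic U
  · have h2 := N.dimVec_reduction hU
    have h3 : hyp σ U.dim ≤ N.dimVec := h2 ▸ le_self_add
    rw [Finset.sum_eq_single_of_mem U.dim ((Set.Finite.mem_toFinset _).2 U.dim_le)]
    · have h4 : N.dimVec - hyp σ U.dim = (N.reduction U).dimVec := by
        rw [← h2, add_tsub_cancel_left]
      simp only [hU, h3, and_true, true_and, Rep.SubRep.dim_ne_zero, h4]
    · intro x _ hx
      rw [ha x U.toRep hx.symm, zero_mul, ite_self]
  · simp [hU]

end Recursion

/-! ### The Harder–Narasimhan recursion and its solution. -/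

section Main

open SelfDualQuiver.Rep

variable {Q : Type v} [Fintype Q] [Quiver.{w} Q] {σ : QuiverInvolution Q}
  {k : Type u} [Field k] [Finite k] [Finite (Quiver.Total Q)] {D : DualityStructure σ}
  {θ : (Q → ℤ) →+ ℤ}

open scoped Classical in
theorem coeff_charRep (d : Q → ℕ) (U : Rep k Q) :
    HallAlgebra.coeff U.cls (charRep k d) = if U.dimVec = d then 1 else 0 := by
  rw [charRep, map_sum]
  simp only [HallAlgebra.coeff_symbol, Finset.sum_ite_eq', Set.Finite.mem_toFinset,
    Set.mem_ofPred_eq, Rep.dimVec_cls]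

open scoped Classical in
theorem coeff_charRepSS (d : Q → ℕ) (U : Rep k Q) :
    HallAlgebra.coeff U.cls (charRepSS k θ d) =
      if U.dimVec = d ∧ U.IsSemistable θ then 1 else 0 := by
  rw [charRepSS, map_sum]
  simp only [HallAlgebra.coeff_symbol, Finset.sum_ite_eq', Set.Finite.mem_toFinset,
    Set.mem_ofPred_eq, Rep.dimVec_cls, Finset.mem_filter, Rep.isSemistable_cls_out]

open scoped Classical in
theorem coeff_charSD (d : Q → ℕ) (N : SDRep k D) :
    HallModule.coeff N.cls (charSD k D d) = if N.dimVec = d then 1 else 0 := by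
  rw [charSD, map_sum]
  simp only [HallModule.coeff_symbol, Finset.sum_ite_eq', Set.Finite.mem_toFinset,
    Set.mem_ofPred_eq, SDRep.dimVec_cls]

open scoped Classical in
theorem coeff_charSDSS (hθ : IsCompatible σ θ) (d : Q → ℕ) (N : SDRep k D) :
    HallModule.coeff N.cls (charSDSS k D θ d) =
      if N.dimVec = d ∧ N.IsSemistable θ then 1 else 0 := by
  rw [charSDSS, map_sum]
  simp only [HallModule.coeff_symbol, Finset.sum_ite_eq', Set.Finite.mem_toFinset,
    Set.mem_ofPred_eq, SDRep.dimVec_cls, Finset.mem_filter, SDRep.isSemistable_cls_out hθ]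

open scoped Classical in
/-- The indicator function of the Harder–Narasimhan types with all slopes in `(0, b)`. -/
def hnWeight (θ : (Q → ℤ) →+ ℤ) (b : WithTop ℚ) (l : List (Q → ℕ)) : ℚ :=
  if l.Pairwise (fun x y => slope θ y < slope θ x) ∧
    ∀ x ∈ l, 0 < slope θ x ∧ (slope θ x : WithTop ℚ) < b then 1 else 0

-- The reason for the bound b: after removal of x, the decrease of slopes becomes the bound μ(x) on
-- the rest.
omit [Quiver.{w} Q] in
open scoped Classical in
theorem hnWeight_cons (θ : (Q → ℤ) →+ ℤ) (b : WithTop ℚ) (x : Q → ℕ) (l : List (Q → ℕ)) :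
    hnWeight θ b (x :: l) =
      (if 0 < slope θ x ∧ (slope θ x : WithTop ℚ) < b then 1 else 0) *
        hnWeight θ (slope θ x) l := by
  rw [hnWeight, hnWeight, ite_zero_mul_ite_zero, mul_one]
  refine if_congr ?_ rfl rfl
  rw [List.pairwise_cons, List.forall_mem_cons]
  constructor
  · rintro ⟨⟨h1, h2⟩, h3, h4⟩
    exact ⟨h3, h2, fun y hy => ⟨(h4 y hy).1, WithTop.coe_lt_coe.2 (h1 y hy)⟩⟩
  · rintro ⟨h3, h2, h4⟩
    exact ⟨⟨fun y hy => WithTop.coe_lt_coe.1 (h4 y hy).2, h2⟩, h3,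
      fun y hy => ⟨(h4 y hy).1, (h4 y hy).2.trans h3.2⟩⟩

theorem weightedSum_const_mul (a : (Q → ℕ) → HallAlgebra k Q) (m : (Q → ℕ) → HallModule k D)
    (d : Q → ℕ) (c : ℚ) (C : List (Q → ℕ) → ℚ) :
    weightedSum a m d (fun l => c * C l) = c • weightedSum a m d C := by
  simp only [weightedSum, mul_smul, Finset.smul_sum]

-- By induction on size, the possible first steps are the destabilizing U of slope less than b. If N
-- is not semistable there is a single destabilizing U, and it has the largest slope among isotropic
-- subrepresentations, so b bounds all of them once it bounds μ(U). If N is semistable only the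
-- empty chain contributes, and all slopes are at most 0 < b.
open scoped Classical in
theorem coeff_weightedSum_hnWeight (hθ : IsCompatible σ θ) (N : SDRep k D) (b : WithTop ℚ)
    (hb : 0 < b) :
    HallModule.coeff N.cls (weightedSum (charRepSS k θ) (charSDSS k D θ) N.dimVec (hnWeight θ b)) =
      if N.SlopesLT θ b then 1 else 0 := by
  induction hn : size N.dimVec using Nat.strong_induction_on generalizing N b with
  | h n ih =>
    subst hn
    have h1 (U : N.rep.SubRep) : (if N.IsIsotropic U ∧ U ≠ ⊥ then
        HallAlgebra.coeff U.toRep.cls (charRepSS k θ U.dim) *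
          HallModule.coeff (N.reduction U).cls (weightedSum (charRepSS k θ) (charSDSS k D θ)
            (N.reduction U).dimVec fun l => hnWeight θ b (U.dim :: l)) else 0) =
        if N.IsDestabilizing θ U ∧ (slope θ U.dim : WithTop ℚ) < b then 1 else 0 := by
      by_cases hU : N.IsIsotropic U ∧ U ≠ ⊥
      · rw [if_pos hU, coeff_charRepSS]
        simp only [hnWeight_cons, weightedSum_const_mul, map_smul, smul_eq_mul]
        by_cases hs : 0 < slope θ U.dim
        · rw [ih _ (SDRep.size_reduction_lt hU.1 hU.2) (N.reduction U) (slope θ U.dim)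
            (WithTop.coe_lt_coe.2 hs) rfl, ite_zero_mul_ite_zero, ite_zero_mul_ite_zero, mul_one,
            mul_one]
          refine if_congr ⟨?_, ?_⟩ rfl rfl
          · rintro ⟨h1, h2, h3⟩
            exact ⟨⟨hU.1, hU.2, h1.2, hs, h3⟩, h2.2⟩
          · rintro ⟨h1, h2⟩
            exact ⟨⟨rfl, h1.semistable⟩, ⟨hs, h2⟩, h1.slopesLT⟩
        · rw [if_neg (c := 0 < slope θ U.dim ∧ _) fun h => hs h.1, zero_mul, mul_zero,
            if_neg fun h => hs h.1.slope_pos]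
      · rw [if_neg hU, if_neg fun h => hU ⟨h.1.isotropic, h.1.ne_bot⟩]
    rw [coeff_weightedSum (fun x U hU => by rw [coeff_charRepSS, if_neg fun h => hU h.1]),
      Finset.sum_congr rfl fun U _ => h1 U, coeff_charSDSS hθ]
    have h2 : hnWeight θ b [] = 1 := if_pos (by simp)
    rw [h2, one_mul]
    simp only [true_and]
    by_cases hss : N.IsSemistable θ
    · have h3 (W : N.rep.SubRep) (hW : N.IsIsotropic W) : slope θ W.dim ≤ 0 := by
        rw [← not_lt, slope_pos_iff, not_lt]
        exact (SDRep.isSemistable_iff hθ).1 hss W hW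
      rw [if_pos hss, if_pos, Finset.sum_eq_zero, add_zero]
      · exact fun U _ => if_neg fun h => (h3 U h.1.isotropic).not_gt h.1.slope_pos
      · exact fun W _ hW => (WithTop.coe_le_coe.2 (h3 W hW)).trans_lt hb
    · obtain ⟨U, hU⟩ := SDRep.exists_isDestabilizing hθ hss
      rw [if_neg hss, zero_add, Finset.sum_eq_single_of_mem U (Finset.mem_univ _)
        fun V _ hne => if_neg fun h => hne (h.1.unique hθ hU)]
      refine if_congr ⟨fun h W hW0 hW => ?_, fun h => ⟨hU, h U hU.ne_bot hU.isotropic⟩⟩ rfl rfl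
      exact (WithTop.coe_le_coe.2 (hU.slope_le hθ hW hW0)).trans_lt h.2

/-- The signed indicator function of the `d^•` with `t + θ(d^1 + ⋯ + d^j) > 0` for all `j ≥ 1`. -/
def solutionWeight (θ : (Q → ℤ) →+ ℤ) (t : ℤ) : List (Q → ℕ) → ℚ
  | [] => 1
  | x :: l => if 0 < t + degree θ x then -solutionWeight θ (t + degree θ x) l else 0

-- The offset t carries the degree of the entries already removed, which makes the conditions on
-- partial sums recursive.
omit [Fintype Q] [Quiver.{w} Q] in
open scoped Classical in
theorem solutionWeight_eq (t : ℤ) (l : List (Q → ℕ)) :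
    solutionWeight θ t l =
      if ∀ j, 1 ≤ j → j ≤ l.length → 0 < t + degree θ (l.take j).sum then
        (-1) ^ l.length else 0 := by
  induction l generalizing t with
  | nil =>
    rw [solutionWeight, if_pos, List.length_nil, pow_zero]
    intro j h1 h2
    rw [List.length_nil] at h2
    omega
  | cons x l ih =>
    rw [solutionWeight, ih]
    have key : (∀ j, 1 ≤ j → j ≤ (x :: l).length → 0 < t + degree θ ((x :: l).take j).sum) ↔
        0 < t + degree θ x ∧
          ∀ j, 1 ≤ j → j ≤ l.length → 0 < t + degree θ x + degree θ (l.take j).sum := by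
      constructor
      · refine fun h => ⟨by simpa using h 1 le_rfl (by simp), fun j _ h2 => ?_⟩
        have h3 := h (j + 1) (by omega) (by simpa using h2)
        rwa [List.take_succ_cons, List.sum_cons, map_add, ← add_assoc] at h3
      · rintro ⟨h0, h⟩ (_ | _ | j) h1 h2
        · omega
        · simpa using h0
        · rw [List.take_succ_cons, List.sum_cons, map_add, ← add_assoc]
          exact h (j + 1) (by omega) (by simpa using h2)
    simp only [key]
    simp only [List.length_cons, pow_succ, mul_neg, mul_one]
    by_cases h0 : 0 < t + degree θ x
    · simp only [h0, true_and, if_true, neg_ite, neg_zero]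
    · simp only [h0, false_and, if_false]

variable (θ) in
/-- The coefficients of the signed sums of the `1_{d^1} ⋯ 1_{d^n} ⋆ 1^σ_{d^∞}`. -/
def solutionCoeff (t : ℤ) (c : IsometryClass k D) : ℚ :=
  HallModule.coeff c (weightedSum (charRep k) (charSD k D) c.dimVec (solutionWeight θ t))

open scoped Classical in
theorem solutionCoeff_cls (t : ℤ) (N : SDRep k D) :
    solutionCoeff θ t N.cls = 1 - ∑ U : N.rep.SubRep, if N.IsIsotropic U then
      (if U ≠ ⊥ ∧ 0 < t + degree θ U.dim then
        solutionCoeff θ (t + degree θ U.dim) (N.reduction U).cls else 0) else 0 := by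
  rw [solutionCoeff, SDRep.dimVec_cls,
    coeff_weightedSum (fun x U hU => by rw [coeff_charRep, if_neg hU]), coeff_charSD, if_pos rfl,
    solutionWeight, mul_one, sub_eq_add_neg, ← Finset.sum_neg_distrib]
  congr 1
  refine Finset.sum_congr rfl fun U _ => ?_
  by_cases hU : N.IsIsotropic U
  swap
  · simp [hU]
  by_cases hb : U ≠ ⊥
  swap
  · simp [hb]
  rw [if_pos ⟨hU, hb⟩, if_pos hU, coeff_charRep, if_pos (show U.toRep.dimVec = U.dim from rfl),
    one_mul]
  have h1 : (fun l => solutionWeight θ t (U.dim :: l)) = fun l =>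
      (if 0 < t + degree θ U.dim then -1 else 0) * solutionWeight θ (t + degree θ U.dim) l := by
    funext l
    rw [solutionWeight]
    split_ifs
    · rw [neg_one_mul]
    · rw [zero_mul]
  rw [h1, weightedSum_const_mul, map_smul, smul_eq_mul]
  by_cases h2 : 0 < t + degree θ U.dim
  · rw [if_pos h2, if_pos ⟨hb, h2⟩, neg_one_mul, solutionCoeff, SDRep.dimVec_cls]
  · rw [if_neg h2, if_neg fun h => h2 h.2, zero_mul, neg_zero]

-- The offset θ(V) is chosen so that θ(V) + θ(W/V) = θ(W): the recursion for N // V is thereby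
-- expressed by the subrepresentations W > V of N alone.
open scoped Classical in
theorem solutionCoeff_reduction {N : SDRep k D} {V : N.rep.SubRep} (hV : N.IsIsotropic V) :
    solutionCoeff θ (degree θ V.dim) (N.reduction V).cls =
      1 - ∑ W : N.rep.SubRep, if N.IsIsotropic W ∧ 0 < degree θ W.dim ∧ V < W then
        solutionCoeff θ (degree θ W.dim) (N.reduction W).cls else 0 := by
  rw [solutionCoeff_cls, SDRep.sum_reduction_subRep hV fun W =>
    if W ≠ ⊥ ∧ 0 < degree θ V.dim + degree θ W.dim then
      solutionCoeff θ (degree θ V.dim + degree θ W.dim) ((N.reduction V).reduction W).cls else 0]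
  congr 1
  refine Finset.sum_congr rfl fun W _ => ?_
  by_cases h : V ≤ W ∧ N.IsIsotropic W
  · have hp : W ≤ N.perp V := (N.isIsotropic_iff.1 h.2).trans (N.perp_anti h.1)
    have h1 : degree θ V.dim + degree θ (N.proj V W).dim = degree θ W.dim := by
      rw [← map_add, SDRep.dim_proj h.1 hp]
    rw [if_pos h, h1, SDRep.reduction_proj_cls h.1 h.2]
    refine if_congr ?_ rfl rfl
    rw [Ne, SDRep.proj_eq_bot_iff h.1 hp]
    exact ⟨fun h' => ⟨h.2, h'.2, lt_of_le_of_ne h.1 (Ne.symm h'.1)⟩,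
      fun h' => ⟨h'.2.2.ne', h'.2.1⟩⟩
  · rw [if_neg h, if_neg fun h' => h ⟨h'.2.2.le, h'.1⟩]

-- The poset argument for the solution: 1 − ∑_P T is minus the reduced Euler characteristic of P,
-- and it vanishes when P is contractible to M.
open scoped Classical in
theorem solutionCoeff_zero (hθ : IsCompatible σ θ) (N : SDRep k D) :
    solutionCoeff θ 0 N.cls = if N.IsSemistable θ then 1 else 0 := by
  obtain ⟨P, hP⟩ : ∃ P : Finset N.rep.SubRep,
    P = Finset.univ.filter fun W => N.IsIsotropic W ∧ 0 < degree θ W.dim := ⟨_, rfl⟩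
  have mem_P (W : N.rep.SubRep) : W ∈ P ↔ N.IsIsotropic W ∧ 0 < degree θ W.dim := by
    simp [hP]
  -- For isotropic W, this is the sum of (-1)^n over the chains of length n in P lying strictly
  -- above W.
  set T : N.rep.SubRep → ℚ := fun W => solutionCoeff θ (degree θ W.dim) (N.reduction W).cls
  have hTsum {V : N.rep.SubRep} (hV : N.IsIsotropic V) : T V = 1 - ∑ W ∈ P with V < W, T W := by
    refine (solutionCoeff_reduction hV).trans ?_
    rw [hP, Finset.filter_filter, Finset.sum_filter]
    simp only [and_assoc, T]
  have h0 : solutionCoeff θ 0 N.cls = 1 - ∑ W ∈ P, T W := by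
    have h1 := hTsum N.isIsotropic_bot
    have h2 : T ⊥ = solutionCoeff θ 0 N.cls := by
      simp only [T, SubRep.dim_bot, map_zero, SDRep.reduction_bot_cls]
    -- The zero subrepresentation has degree 0 and lies strictly below every member of P.
    rw [← h2, h1, Finset.filter_true_of_mem]
    intro W hW
    refine bot_lt_iff_ne_bot.2 ?_
    rintro rfl
    have := ((mem_P _).1 hW).2
    rw [SubRep.dim_bot, map_zero] at this
    exact lt_irrefl _ this
  rw [h0]
  by_cases hss : N.IsSemistable θ
  · rw [if_pos hss, Finset.sum_eq_zero, sub_zero]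
    intro W hW
    rw [mem_P] at hW
    exact (((SDRep.isSemistable_iff hθ).1 hss W hW.1).not_gt hW.2).elim
  rw [if_neg hss, sub_eq_zero, eq_comm]
  have : Nonempty {V : N.rep.SubRep // N.IsIsotropic V} := ⟨⟨⊥, N.isIsotropic_bot⟩⟩
  obtain ⟨⟨M, hM⟩, hmax⟩ := Finite.exists_max fun V : {V : N.rep.SubRep // N.IsIsotropic V} =>
    degree θ V.1.dim
  have hMpos : 0 < degree θ M.dim := by
    rw [SDRep.isSemistable_iff hθ] at hss
    push Not at hss
    obtain ⟨W, hW, h⟩ := hss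
    exact h.trans_le (hmax ⟨W, hW⟩)
  have hMp : M ≤ N.perp M := N.isIsotropic_iff.1 hM
  refine sum_eq_one_of_conical (r := fun V => V ⊓ N.perp M) (q := fun V => V ⊔ M) (M := M)
    (fun V hV => ?_) ((mem_P M).2 ⟨hM, hMpos⟩) (inf_eq_left.2 hMp) (fun V hV => ?_)
    (fun V => inf_le_left) (fun V => ?_) (fun V W h => inf_le_inf_right _ h) (fun V hV hr => ?_)
    (fun V W => sup_le_iff)
  · have h1 := hTsum ((mem_P V).1 hV).1
    have h2 : (P.filter fun W => V ≤ W) = insert V (P.filter fun W => V < W) := by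
      ext W
      rw [Finset.mem_insert, Finset.mem_filter, Finset.mem_filter, le_iff_eq_or_lt]
      constructor
      · rintro ⟨h, rfl | h'⟩
        · exact Or.inl rfl
        · exact Or.inr ⟨h, h'⟩
      · rintro (rfl | h)
        · exact ⟨hV, Or.inl rfl⟩
        · exact ⟨h.1, Or.inr h.2⟩
    rw [h2, Finset.sum_insert fun h => lt_irrefl _ (Finset.mem_filter.1 h).2, h1, sub_add_cancel]
  · rw [mem_P] at hV ⊢
    refine ⟨hV.1.mono inf_le_left, hV.2.trans_le ?_⟩
    -- M ∩ V^⊥ is isotropic, so its degree is at most θ(M); therefore θ(V ∩ M^⊥) ≥ θ(V).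
    have h1 := SDRep.degree_inf_perp hθ V M
    have h2 := hmax ⟨M ⊓ N.perp V, hM.mono inf_le_left⟩
    simp only at h2
    linarith
  · exact inf_eq_left.2 inf_le_right
  · rw [mem_P] at hV ⊢
    have hVp : V ≤ N.perp M := inf_eq_left.1 hr
    refine ⟨⟨hV.1.sup hM hVp, hV.2.trans_le ?_⟩, inf_eq_left.2 (sup_le hVp hMp)⟩
    -- Likewise θ(V ∩ M) ≤ θ(M), whence θ(V + M) ≥ θ(V); the sum is isotropic because V ≤ M^⊥.
    have h1 := SDRep.degree_sup_add_degree_inf θ V M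
    have h2 := hmax ⟨V ⊓ M, hM.mono inf_le_right⟩
    simp only at h2
    linarith

theorem charSD_eq_weightedSum (hθ : IsCompatible σ θ) (d : Q → ℕ) :
    charSD k D d = weightedSum (charRepSS k θ) (charSDSS k D θ) d (hnWeight θ ⊤) := by
  classical
  refine HallModule.ext_coeff fun N => ?_
  rw [coeff_charSD]
  by_cases h : N.dimVec = d
  · subst h
    rw [if_pos rfl, coeff_weightedSum_hnWeight hθ N ⊤ (WithTop.coe_lt_top 0),
      if_pos (show N.SlopesLT θ ⊤ from fun W _ _ => WithTop.coe_lt_top _)]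
  · rw [if_neg h, coeff_weightedSum_eq_zero _ _ _ h]
    · exact fun x U hU => by rw [coeff_charRepSS, if_neg fun h => hU h.1]
    · exact fun x M hM => by rw [coeff_charSDSS hθ, if_neg fun h => hM h.1]

theorem charSDSS_eq_weightedSum (hθ : IsCompatible σ θ) (d : Q → ℕ) :
    charSDSS k D θ d = weightedSum (charRep k) (charSD k D) d (solutionWeight θ 0) := by
  classical
  refine HallModule.ext_coeff fun N => ?_
  rw [coeff_charSDSS hθ]
  by_cases h : N.dimVec = d
  · subst h
    have h1 := solutionCoeff_zero hθ N
    rw [solutionCoeff, SDRep.dimVec_cls] at h1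
    simp only [h1, true_and]
  · rw [if_neg fun h' => h h'.1, coeff_weightedSum_eq_zero _ _ _ h]
    · exact fun x U hU => by rw [coeff_charRep, if_neg hU]
    · exact fun x M hM => by rw [coeff_charSD, if_neg hM]

end Main

end SelfDualQuiver

end

theorem mainTheorem4 {k : Type u} [Field k] [Finite k] (hk : (2 : k) ≠ 0)
    {Q : Type v} [Fintype Q] [Quiver.{w} Q] [Finite (Quiver.Total Q)]
    (σ : QuiverInvolution Q) (D : DualityStructure σ)
    (θ : (Q → ℤ) →+ ℤ) (hθ : IsCompatible σ θ)
    (d : Q → ℕ) (hd : IsInvariant σ d) :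
    charSD k D d = ∑ p ∈ (finite_hnSet σ θ d).toFinset,
        HallModule.act (p.1.map (charRepSS k θ)).prod (charSDSS k D θ p.2) ∧
    charSDSS k D θ d = ∑ p ∈ (finite_solutionSet σ θ d).toFinset,
        (-1 : ℚ) ^ p.1.length • HallModule.act (p.1.map (charRep k)).prod (charSD k D p.2) := by
  classical
  constructor
  · rw [charSD_eq_weightedSum hθ, weightedSum]
    simp only [hnWeight, ite_smul, one_smul, zero_smul]
    rw [← Finset.sum_filter]
    refine Finset.sum_congr (Finset.ext fun p => ?_) fun _ _ => rfl
    rw [Finset.mem_filter, Set.Finite.mem_toFinset, Set.Finite.mem_toFinset]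
    -- For b = ⊤ the upper bound on the slopes is void and exactly the conditions of `hnSet` remain.
    simp only [WithTop.coe_lt_top, and_true]
    rfl
  · rw [charSDSS_eq_weightedSum hθ, weightedSum]
    simp only [solutionWeight_eq, ite_smul, zero_smul, zero_add, ← SelfDualQuiver.slope_pos_iff]
    rw [← Finset.sum_filter]
    refine Finset.sum_congr (Finset.ext fun p => ?_) fun _ _ => rfl
    rw [Finset.mem_filter, Set.Finite.mem_toFinset, Set.Finite.mem_toFinset]
    refine ⟨fun h => Or.inr h, ?_⟩
    -- The separately listed index (∅; d) already has σ-weight d because d is invariant, and its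
    -- condition on partial sums is empty.
    rintro (rfl | h)
    · refine ⟨⟨by simp, hd, by simp⟩, fun j h1 h2 => ?_⟩
      rw [List.length_nil] at h2
      omega
    · exact h
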